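/- A $3s/3t$ sum-network $\mathcal N$ is a finite directed acyclic multigraph with three distinct source nodes and three distinct terminal nodes (no node being both a source and a terminal). Each edge goes from its tail to its head. Source $i$ generates a symbol $x_i$ of a finite field $F$, every edge carries one symbol of $F$ (a function of the symbols generated at its tail and of the symbols on the edges entering its tail), and every terminal has to recover $x_1+x_2+x_3$ from the symbols on its incoming edges. $\mathcal N$ is solvable if this is possible, by possibly nonlinear functions, over at least one finite field $F$, and nonsolvable otherwise. It is XOR solvable over $F$ if it is possible with every node, terminals included, only adding and subtracting symbols available to it (all coding coefficients are $\pm1$, or $0$ for unused symbols). $\mathcal N$ is connected if there is a path from every source to every terminal; $\kappa(\mathcal N)$ is the maximum number of source-terminal pairs that can be disconnected by removing a single edge; $\mathrm{mincut}(A,B)$ is the least number of edges whose removal leaves no path from any node of $A$ to any node of $B$; and for edges, $e\nrightarrow e'$ means that there is no path (a single node counting as a path) from the head of $e$ to the tail of $e'$. For a labeling $s_1,s_2,s_3$ of the sources and $t_1,t_2,t_3$ of the terminals, and edges $e_1,e_2$, consider the conditions: 1. $\mathrm{mincut}(\{s_1\},\{t_3\})=0$ in $\mathcal N-\{e_1\}$;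 2. $\mathrm{mincut}(\{s_3\},\{t_1\})=0$ in $\mathcal N-\{e_1\}$; 3. $\mathrm{mincut}(\{s_2\},\{t_3\})=0$ in $\mathcal N-\{e_2\}$; 4. $\mathrm{mincut}(\{s_2,s_3\},\{t_2\})=0$ in $\mathcal N-\{e_2\}$; 5. $\mathrm{mincut}(\{s_3\},\{t_3\})=0$ in $\mathcal N-\{e_1,e_2\}$; 6. $e_1\nrightarrow e_2$ and $e_2\nrightarrow e_1$. Lemma. Let $\mathcal N$ be a connected $3s/3t$ sum-network with $\kappa(\mathcal N)=3$, and suppose that for some labeling of its sources and terminals an edge $e_2$ satisfies conditions 3 and 4. Then $\mathcal N$ is nonsolvable only if there is another edge $e_1\neq e_2$ such that $e_1,e_2$ satisfy all six conditions for the same labeling. If there is no such $e_1$, then $\mathcal N$ is XOR solvable over all finite fields. Moreover, $\mathcal N$ is either nonsolvable or XOR solvable over all finite fields. -/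

import Mathlib

open scoped BigOperators

/-- A sum-network on a directed acyclic multigraph with node set `V` and edge set `E`: the edge `e`
goes from `tail e` to `head e`, the sources are indexed by `S` and the terminals by `T`. -/
structure SumNetwork (V E S T : Type*) where
  tail : E → V
  head : E → V
  acyclic : ∀ v, ¬ Relation.TransGen (fun u w => ∃ e, tail e = u ∧ head e = w) v v
  source : S → V
  terminal : T → V
  source_injective : Function.Injective source
  terminal_injective : Function.Injective terminal
  source_ne_terminal : ∀ i j, source i ≠ terminal j

namespace SumNetwork

/-- There is a directed path from `u` to `v` in the network from which the edges in `R` have been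
removed. (A single node is a path.) -/
def Reach {V E S T : Type*} (N : SumNetwork V E S T) (R : Set E) (u v : V) : Prop :=
  Relation.ReflTransGen (fun a b => ∃ e, e ∉ R ∧ N.tail e = a ∧ N.head e = b) u v

/-- Every source has a path to every terminal. -/
def Connected {V E S T : Type*} (N : SumNetwork V E S T) : Prop :=
  ∀ i j, N.Reach ∅ (N.source i) (N.terminal j)

/-- `e → f` for edges: there is a path from the head of `e` to the tail of `f`. -/
def EdgeReach {V E S T : Type*} (N : SumNetwork V E S T) (e f : E) : Prop :=
  N.Reach ∅ (N.head e) (N.tail f)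

/-- `A ↛ B` after removing the edges in `R`: no node of `A` has a path to any node of `B`. -/
def NoPath {V E S T : Type*} (N : SumNetwork V E S T) (R : Set E) (A B : Set V) : Prop :=
  ∀ a ∈ A, ∀ b ∈ B, ¬ N.Reach R a b

/-- `mincut (A, B)` in the network from which the edges in `R` have been removed: the least number
of edges whose (further) removal causes `A ↛ B`. -/
noncomputable def mincut {V E S T : Type*} (N : SumNetwork V E S T) (R : Set E) (A B : Set V) :
    ℕ∞ :=
  ⨅ (D : Set E) (_ : N.NoPath (R ∪ D) A B), D.encard

/-- The removal of the edge `e` disconnects the ordered pair of nodes `(u, v)`. -/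
def Disconnects {V E S T : Type*} (N : SumNetwork V E S T) (e : E) (u v : V) : Prop :=
  N.Reach ∅ u v ∧ ¬ N.Reach {e} u v

/-- The maximum-disconnectivity `κ`: the maximum number of source-terminal pairs that can be
disconnected by removing a single edge. -/
noncomputable def kappa {V E S T : Type*} (N : SumNetwork V E S T) : ℕ∞ :=
  ⨆ e : E, {p : S × T | N.Disconnects e (N.source p.1) (N.terminal p.2)}.encard

/-- Solvability over the alphabet `F` by an arbitrary (possibly nonlinear) scalar network code.
The symbol `y x e` on the edge `e`, for source symbols `x`, is a function (`enc e`) of the symbols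
generated at the tail of `e` and of the symbols on the edges entering the tail of `e`; every
terminal recovers (by `dec j`) the sum of the source symbols from the edges entering it. -/
def SolvableOver {V E S T : Type*} [Fintype S] (N : SumNetwork V E S T)
    (F : Type*) [Field F] : Prop :=
  ∃ (enc : ∀ e : E, ({i : S // N.source i = N.tail e} → F) →
        ({f : E // N.head f = N.tail e} → F) → F)
    (dec : ∀ j : T, ({f : E // N.head f = N.terminal j} → F) → F)
    (y : (S → F) → E → F),
    (∀ x e, y x e = enc e (fun i => x i) (fun f => y x f)) ∧
    (∀ x j, dec j (fun f => y x f) = ∑ i, x i)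

/-- Solvable over at least one finite field. (Every finite field is isomorphic to one in
`Type`.) A network is nonsolvable if it is not `Solvable`. -/
def Solvable {V E S T : Type*} [Fintype S] (N : SumNetwork V E S T) : Prop :=
  ∃ (F : Type) (_ : Field F) (_ : Finite F), N.SolvableOver F

/-- Solvability over `F` by an XOR code: all nodes, including the terminals, only add and subtract
symbols available to them. So all coding coefficients (`a` at the sources, `b` at the edges, `c` at
the terminals) are `1`, `-1`, or `0` where the symbol is not used. -/
def XORSolvableOver {V E S T : Type*} [DecidableEq V] [Fintype E] [Fintype S]
    (N : SumNetwork V E S T) (F : Type*) [Field F] : Prop :=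
  ∃ (a : S → E → F) (b : E → E → F) (c : E → T → F) (y : (S → F) → E → F),
    (∀ i e, a i e = 0 ∨ a i e = 1 ∨ a i e = -1) ∧
    (∀ f e, b f e = 0 ∨ b f e = 1 ∨ b f e = -1) ∧
    (∀ f j, c f j = 0 ∨ c f j = 1 ∨ c f j = -1) ∧
    (∀ x e, y x e = ∑ i with N.source i = N.tail e, a i e * x i +
        ∑ f with N.head f = N.tail e, b f e * y x f) ∧
    (∀ x j, ∑ f with N.head f = N.terminal j, c f j * y x f = ∑ i, x i)

/-- XOR solvable over all (finite) fields. -/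
def XORSolvableOverAllFields {V E S T : Type*} [DecidableEq V] [Fintype E] [Fintype S]
    (N : SumNetwork V E S T) : Prop :=
  ∀ (F : Type) [Field F] [Finite F], N.XORSolvableOver F

/-- Conditions 3 and 4, on `e₂`, for the labeling `s₁, s₂, s₃ = s 0, s 1, s 2` of the sources and
`t₁, t₂, t₃ = t 0, t 1, t 2` of the terminals. -/
structure Conditions34 {V E S T : Type*} (N : SumNetwork V E S T) (s t : Fin 3 → V) (e₂ : E) :
    Prop where
  cond3 : N.mincut {e₂} {s 1} {t 2} = 0
  cond4 : N.mincut {e₂} {s 1, s 2} {t 1} = 0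

/-- All six conditions on `e₁, e₂`, for the labeling `s₁, s₂, s₃ = s 0, s 1, s 2` of the sources
and `t₁, t₂, t₃ = t 0, t 1, t 2` of the terminals. -/
structure SixConditions {V E S T : Type*} (N : SumNetwork V E S T) (s t : Fin 3 → V) (e₁ e₂ : E) :
    Prop extends N.Conditions34 s t e₂ where
  cond1 : N.mincut {e₁} {s 0} {t 2} = 0
  cond2 : N.mincut {e₁} {s 2} {t 0} = 0
  cond5 : N.mincut {e₁, e₂} {s 2} {t 2} = 0
  cond6 : ¬ N.EdgeReach e₁ e₂ ∧ ¬ N.EdgeReach e₂ e₁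

end SumNetwork

/-! Number sources and terminals 0, 1, 2 and write x₀, x₁, x₂ for the source symbols. Two facts give
all three claims: the six conditions exclude every code over a finite field, and if no `e₁`
satisfies them together with `e₂`, there is an explicit XOR code.

Impossibility (`SixConditions.not_solvable`): `e₁` carries a function of x₀, x₂ and `e₂` one of x₁,
x₂. Terminal 0 forces `e₁` to be injective in x₂; terminal 1 forces `e₂` to determine x₁ + x₂, and
finiteness then makes `e₂` a function of x₁ + x₂. Hence some input (1, -c, c) looks like 0 on both
edges, and terminal 2 confuses the sums 1 and 0.

Construction, with e = `e₂`: if source 0 also reaches e, the whole sum is formed at e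
(`xorSolvable_of_sum_edge`). If sources 1 and 2 meet at a node that leads to e and to terminal 0, x₁
+ x₂ is formed there for everybody (`xorSolvable_of_pair_node`). Otherwise e is a `Bottleneck`
supplying x₁ + x₂ to terminals 1 and 2, while κ = 3 leaves a path from source 2 to terminal 2 off e.
Now terminal 2 must isolate x₀ and terminal 0 must still get x₂, though both symbols may compete for
the same edges. A `Splitting` resolves this: x₂ is released at a node `m`, the edges of `Q` are
reserved for x₀, and x₂ is subtracted where x₀ joins `Q`. Menger's theorem for two edge-disjoint
paths produces a splitting unless a single edge blocks it, and that edge is an `e₁`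
(`exists_splitting`).

Codes are given by integer coding vectors, so one code serves all fields. Symbols are routed along
forests in which each input is used at most once, so all coefficients stay 0 or ±1
(`exists_forest_code`). -/

namespace SumNetwork

/-! ### Paths in the acyclic multigraph. -/

section Reach

variable {V E S T : Type*} {N : SumNetwork V E S T} {R R' : Set E} {a b c : V} {f h : E}

theorem Reach.refl (N : SumNetwork V E S T) (R : Set E) (a : V) : N.Reach R a a :=
  Relation.ReflTransGen.refl

theorem Reach.trans (h₁ : N.Reach R a b) (h₂ : N.Reach R b c) : N.Reach R a c :=
  Relation.ReflTransGen.trans h₁ h₂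

theorem Reach.edge (hf : f ∉ R) : N.Reach R (N.tail f) (N.head f) :=
  Relation.ReflTransGen.single ⟨f, hf, rfl, rfl⟩

theorem Reach.mono (hR : R ⊆ R') (h : N.Reach R' a b) : N.Reach R a b :=
  Relation.ReflTransGen.mono
    (fun _ _ ⟨f, hf, h₁, h₂⟩ => ⟨f, fun h' => hf (hR h'), h₁, h₂⟩) _ _ h

theorem Reach.empty (h : N.Reach R a b) : N.Reach ∅ a b :=
  h.mono (Set.empty_subset _)

theorem Reach.cons (hf : f ∉ R) (h : N.Reach R (N.head f) b) : N.Reach R (N.tail f) b :=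
  (Reach.edge hf).trans h

theorem Reach.snoc (h : N.Reach R a (N.tail f)) (hf : f ∉ R) : N.Reach R a (N.head f) :=
  h.trans (Reach.edge hf)

/-- A nontrivial path has a last edge. -/
theorem Reach.cases_snoc (h : N.Reach R a b) :
    b = a ∨ ∃ f, f ∉ R ∧ N.Reach R a (N.tail f) ∧ N.head f = b := by
  rcases Relation.ReflTransGen.cases_tail h with h | ⟨c, hc, f, hf, h₁, h₂⟩
  · exact Or.inl h
  · exact Or.inr ⟨f, hf, by rw [h₁]; exact hc, h₂⟩

/-- A nontrivial path has a first edge. -/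
theorem Reach.cases_cons (h : N.Reach R a b) :
    a = b ∨ ∃ f, f ∉ R ∧ N.tail f = a ∧ N.Reach R (N.head f) b := by
  rcases Relation.ReflTransGen.cases_head h with h | ⟨c, ⟨f, hf, h₁, h₂⟩, hc⟩
  · exact Or.inl h
  · exact Or.inr ⟨f, hf, h₁, by rw [h₂]; exact hc⟩

@[elab_as_elim]
theorem Reach.induction {P : V → Prop} (h : N.Reach R a b) (base : P a)
    (step : ∀ f, f ∉ R → N.Reach R a (N.tail f) → P (N.tail f) → P (N.head f)) : P b := by
  induction h with
  | refl => exact base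
  | tail hab hbc ih =>
    obtain ⟨f, hf, rfl, rfl⟩ := hbc
    exact step f hf hab ih

@[elab_as_elim]
theorem Reach.induction_head {P : V → Prop} (h : N.Reach R a b) (base : P b)
    (step : ∀ f, f ∉ R → N.Reach R (N.head f) b → P (N.head f) → P (N.tail f)) : P a := by
  induction h using Relation.ReflTransGen.head_induction_on with
  | refl => exact base
  | head hab hbc ih =>
    obtain ⟨f, hf, rfl, rfl⟩ := hab
    exact step f hf hbc ih

theorem Reach.not_back (h : N.Reach R (N.head f) (N.tail f)) : False := by
  refine N.acyclic (N.tail f) ?_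
  refine Relation.TransGen.head' (b := N.head f) ⟨f, rfl, rfl⟩ ?_
  exact Relation.ReflTransGen.mono (fun _ _ ⟨f, _, h₁, h₂⟩ => ⟨f, h₁, h₂⟩) _ _ h

theorem Reach.antisymm (h₁ : N.Reach R a b) (h₂ : N.Reach R' b a) : a = b := by
  rcases h₁.cases_cons with h | ⟨f, -, rfl, hf⟩
  · exact h
  · exact (hf.empty.trans h₂.empty).not_back.elim

/-- A path either avoids a given edge or passes through it exactly once. -/
theorem Reach.split (f : E) (h : N.Reach R a b) : N.Reach (insert f R) a b ∨
    (f ∉ R ∧ N.Reach (insert f R) a (N.tail f) ∧ N.Reach (insert f R) (N.head f) b) := by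
  refine h.induction (Or.inl (Reach.refl _ _ _)) ?_
  intro h hh _ ih
  by_cases hf : h = f
  · subst hf
    refine Or.inr ⟨hh, ?_, Reach.refl _ _ _⟩
    rcases ih with ih | ⟨-, ih, -⟩ <;> exact ih
  · have hh' : h ∉ insert f R := by simp [hf, hh]
    rcases ih with ih | ⟨h₀, h₁, h₂⟩
    · exact Or.inl (ih.snoc hh')
    · exact Or.inr ⟨h₀, h₁, h₂.snoc hh'⟩

theorem Reach.avoid (h : N.Reach R a b) (hf : ¬ N.Reach ∅ (N.head f) b) :
    N.Reach (insert f R) a b :=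
  (h.split f).resolve_right fun h' => hf h'.2.2.empty

theorem Reach.avoid_left (h : N.Reach R a b) (hf : ¬ N.Reach ∅ a (N.tail f)) :
    N.Reach (insert f R) a b :=
  (h.split f).resolve_right fun h' => hf h'.2.1.empty

/-- The edge relation "there is a path from the head of `e` to the tail of `f`" is well founded. -/
theorem wellFounded_edgeReach [Finite E] (N : SumNetwork V E S T) :
    WellFounded N.EdgeReach := by
  have : IsTrans E N.EdgeReach :=
    ⟨fun a b c h₁ h₂ => h₁.trans (Reach.cons (Set.notMem_empty b) h₂)⟩
  have : Std.Irrefl N.EdgeReach := ⟨fun a h => Reach.not_back h⟩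
  exact Finite.wellFounded_of_trans_of_irrefl _

theorem wellFounded_edgeReach_swap [Finite E] (N : SumNetwork V E S T) :
    WellFounded (fun e f => N.EdgeReach f e) := by
  have : IsTrans E (fun e f => N.EdgeReach f e) :=
    ⟨fun a b c h₁ h₂ => Reach.trans h₂ (Reach.cons (Set.notMem_empty b) h₁)⟩
  have : Std.Irrefl (fun e f => N.EdgeReach f e) := ⟨fun a h => Reach.not_back h⟩
  exact Finite.wellFounded_of_trans_of_irrefl _

/-- A path avoids every set of edges none of which lies on it. -/
theorem Reach.restrict (h : N.Reach R a b)
    (hR : ∀ f, f ∉ R → N.Reach R a (N.tail f) → N.Reach R (N.head f) b → f ∉ R') :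
    N.Reach R' a b := by
  suffices H : ∀ c, N.Reach R a c → N.Reach R c b → N.Reach R' c b from H a (Reach.refl _ _ _) h
  intro c hac hcb
  revert hac
  refine hcb.induction_head (fun _ => Reach.refl _ _ _) ?_
  intro f hf hfb ih hac
  exact (ih (hac.snoc hf)).cons (hR f hf hac hfb)

/-- After its last node in a set of nodes, a path only uses edges whose head is outside the set. -/
theorem Reach.last_exit {C : V → Prop} (h : N.Reach R a b) (ha : C a) (hb : ¬ C b) :
    ∃ w, C w ∧ N.Reach R a w ∧ N.Reach (R ∪ {f | C (N.head f)}) w b := by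
  suffices H : C b ∨ ∃ w, C w ∧ N.Reach R a w ∧ N.Reach (R ∪ {f | C (N.head f)}) w b from
    H.resolve_left hb
  refine h.induction (Or.inl ha) ?_
  intro f hf hr ih
  by_cases hc : C (N.head f)
  · exact Or.inl hc
  · have hf' : f ∉ R ∪ {f | C (N.head f)} := by simp [hf, hc]
    rcases ih with ih | ⟨w, hw, h₁, h₂⟩
    · exact Or.inr ⟨_, ih, hr, Reach.edge hf'⟩
    · exact Or.inr ⟨w, hw, h₁, h₂.snoc hf'⟩

/-- A path that enters a set has an edge that enters it. -/
theorem Reach.entry {D : V → Prop} (h : N.Reach R a b) (ha : ¬ D a) (hb : D b) :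
    ∃ f, f ∉ R ∧ ¬ D (N.tail f) ∧ D (N.head f) ∧ N.Reach R a (N.tail f) ∧
      N.Reach R (N.head f) b := by
  suffices H : ∀ c, N.Reach R a c → N.Reach R c b → ¬ D c →
      ∃ f, f ∉ R ∧ ¬ D (N.tail f) ∧ D (N.head f) ∧ N.Reach R a (N.tail f) ∧
      N.Reach R (N.head f) b from H a (Reach.refl _ _ _) h ha
  intro c hac hcb
  revert hac
  refine hcb.induction_head (fun _ h => (h hb).elim) ?_
  intro f hf hfb ih hac hc
  by_cases hD : D (N.head f)
  · exact ⟨f, hf, hc, hD, hac, hfb⟩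
  · exact ih (hac.snoc hf) hD

end Reach

/-! ### Vanishing mincuts and the bound given by κ. -/

section Mincut

variable {V E S T : Type*} {N : SumNetwork V E S T}

theorem mincut_eq_zero_iff {R : Set E} {A B : Set V} : N.mincut R A B = 0 ↔ N.NoPath R A B := by
  constructor
  · intro h
    simp only [mincut, iInf_subtype', ENat.iInf_eq_zero, Set.encard_eq_zero] at h
    obtain ⟨⟨D, hD⟩, rfl⟩ := h
    simpa using hD
  · intro h
    unfold mincut
    refine le_antisymm ?_ bot_le
    refine (iInf₂_le ∅ (by simpa using h)).trans (by simp)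

theorem mincut_singleton_eq_zero_iff {R : Set E} {a b : V} :
    N.mincut R {a} {b} = 0 ↔ ¬ N.Reach R a b := by
  simp [mincut_eq_zero_iff, NoPath]

theorem mincut_pair_eq_zero_iff {R : Set E} {a a' b : V} :
    N.mincut R {a, a'} {b} = 0 ↔ ¬ N.Reach R a b ∧ ¬ N.Reach R a' b := by
  simp [mincut_eq_zero_iff, NoPath]

/-- If the removal of `e` disconnects three source-terminal pairs, and `κ` is at most `3`, then it
disconnects no other pair. -/
theorem reach_of_kappa_le {e : E} (hκ : N.kappa ≤ 3) (hconn : N.Connected) {p₁ p₂ p₃ : S × T}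
    (h₁₂ : p₁ ≠ p₂) (h₁₃ : p₁ ≠ p₃) (h₂₃ : p₂ ≠ p₃)
    (h₁ : ¬ N.Reach {e} (N.source p₁.1) (N.terminal p₁.2))
    (h₂ : ¬ N.Reach {e} (N.source p₂.1) (N.terminal p₂.2))
    (h₃ : ¬ N.Reach {e} (N.source p₃.1) (N.terminal p₃.2)) {p : S × T}
    (hp₁ : p ≠ p₁) (hp₂ : p ≠ p₂) (hp₃ : p ≠ p₃) :
    N.Reach {e} (N.source p.1) (N.terminal p.2) := by
  by_contra h
  have hle : {p : S × T | N.Disconnects e (N.source p.1) (N.terminal p.2)}.encard ≤ 3 :=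
    (le_iSup (fun e => {p : S × T | N.Disconnects e (N.source p.1) (N.terminal p.2)}.encard)
      e).trans hκ
  have hsub : ({p, p₁, p₂, p₃} : Set (S × T)) ⊆
      {p : S × T | N.Disconnects e (N.source p.1) (N.terminal p.2)} := by
    rintro q (rfl | rfl | rfl | rfl)
    exacts [⟨hconn _ _, h⟩, ⟨hconn _ _, h₁⟩, ⟨hconn _ _, h₂⟩, ⟨hconn _ _, h₃⟩]
  have hcard : ({p, p₁, p₂, p₃} : Set (S × T)).encard = 4 := by
    rw [Set.encard_insert_of_notMem (by simp [hp₁, hp₂, hp₃]),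
      Set.encard_insert_of_notMem (by simp [h₁₂, h₁₃]), Set.encard_pair h₂₃]
    norm_num
  have := (Set.encard_le_encard hsub).trans hle
  rw [hcard] at this
  exact absurd this (by decide)

end Mincut

/-! ### The six conditions exclude every code over a finite field. -/

section Nonsolvable

variable {V E S T : Type*} {N : SumNetwork V E S T}

/-- Symbols that agree on the edges in `R` agree on every edge whose tail cannot be reached, in the
network without `R`, from a source whose symbol has changed. -/
theorem symbol_congr [Finite E] {F : Type*} {enc : ∀ e : E, ({i : S // N.source i = N.tail e} → F) →
      ({f : E // N.head f = N.tail e} → F) → F} {y : (S → F) → E → F}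
    (hy : ∀ x e, y x e = enc e (fun i => x i) (fun f => y x f)) {R : Set E} {x x' : S → F}
    (hR : ∀ f ∈ R, y x f = y x' f) (f : E)
    (hf : ∀ i, N.Reach R (N.source i) (N.tail f) → x i = x' i) : y x f = y x' f := by
  induction f using N.wellFounded_edgeReach.induction with
  | _ f ih =>
  rw [hy x f, hy x' f]
  congr 1
  · funext ⟨i, hi⟩
    exact hf i (by rw [hi]; exact Reach.refl _ _ _)
  · funext ⟨g, hg⟩
    by_cases hgR : g ∈ R
    · exact hR g hgR
    · refine ih g (by unfold EdgeReach; rw [hg]; exact Reach.refl _ _ _) fun i hi => hf i ?_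
      rw [← hg]
      exact hi.snoc hgR

/-- The cut argument: inputs that agree on the cut edges and on every source not cut off from
terminal `j` look the same to it, so their sums must coincide. -/
theorem sum_congr_of_terminal [Finite E] [Fintype S] {F : Type*} [Field F]
    {enc : ∀ e : E, ({i : S // N.source i = N.tail e} → F) →
      ({f : E // N.head f = N.tail e} → F) → F} {y : (S → F) → E → F}
    (hy : ∀ x e, y x e = enc e (fun i => x i) (fun f => y x f))
    {dec : ∀ j : T, ({f : E // N.head f = N.terminal j} → F) → F}
    (hdec : ∀ x j, dec j (fun f => y x f) = ∑ i, x i)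
    {R : Set E} {x x' : S → F} (hR : ∀ f ∈ R, y x f = y x' f) (j : T)
    (hj : ∀ i, N.Reach R (N.source i) (N.terminal j) → x i = x' i) :
    ∑ i, x i = ∑ i, x' i := by
  rw [← hdec x j, ← hdec x' j]
  congr 1
  funext ⟨g, hg⟩
  by_cases hgR : g ∈ R
  · exact hR g hgR
  · refine symbol_congr hy hR g fun i hi => hj i ?_
    rw [← hg]
    exact hi.snoc hgR

/-- The inputs 0 and (1, -c, c), for a suitable c, have different sums but agree on `e₁` and `e₂`,
which together cut terminal 2 off from every source. -/
theorem SixConditions.not_solvable [Finite E] {N : SumNetwork V E (Fin 3) (Fin 3)}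
    (hconn : N.Connected) {e₁ e₂ : E} (hne : e₁ ≠ e₂)
    (h : N.SixConditions N.source N.terminal e₁ e₂) :
    ¬ N.Solvable := by
  rintro ⟨F, _, _, enc, dec, y, hy, hdec⟩
  obtain ⟨⟨c3, c4⟩, c1, c2, c5, c6, c7⟩ := h
  rw [mincut_singleton_eq_zero_iff] at c1 c2 c3 c5
  rw [mincut_pair_eq_zero_iff] at c4
  have split_bot : ∀ {a b : V} (f : E), N.Reach ∅ a b → ¬ N.Reach {f} a b →
      N.Reach ∅ a (N.tail f) ∧ N.Reach ∅ (N.head f) b := fun {a b} f h₁ h₂ => by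
    rcases h₁.split f with h | ⟨-, h, h'⟩
    · exact (h₂ (by simpa using h)).elim
    · exact ⟨h.empty, h'.empty⟩
  -- a source whose symbol reaches the last terminal only through `f` does not reach `e`
  have key : ∀ {i : Fin 3} {e f : E}, N.Reach ∅ (N.head e) (N.terminal 2) →
      ¬ N.Reach {f} (N.source i) (N.terminal 2) → ¬ N.EdgeReach e f → ¬ N.EdgeReach f e →
      e ≠ f → ¬ N.Reach ∅ (N.source i) (N.tail e) := by
    intro i e f he hi hef hfe hne hr
    refine hi ?_
    have h₁ : N.Reach (insert f ∅) (N.source i) (N.tail e) := hr.avoid hfe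
    have h₂ : N.Reach (insert f ∅) (N.head e) (N.terminal 2) := he.avoid_left hef
    have := h₁.trans (Reach.cons (by simpa using hne) h₂)
    simpa using this
  have h1 : ¬ N.Reach ∅ (N.source 1) (N.tail e₁) :=
    key (split_bot e₁ (hconn 0 2) c1).2 c3 c6 c7 hne
  have h2 : ¬ N.Reach ∅ (N.source 0) (N.tail e₂) :=
    key (split_bot e₂ (hconn 1 2) c3).2 c1 c7 c6 hne.symm
  have congr₁ : ∀ x x' : Fin 3 → F, x 0 = x' 0 → x 2 = x' 2 → y x e₁ = y x' e₁ := by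
    intro x x' h0 h2
    refine symbol_congr hy (R := ∅) (by simp) e₁ fun i hi => ?_
    fin_cases i
    exacts [h0, (h1 hi).elim, h2]
  have congr₂ : ∀ x x' : Fin 3 → F, x 1 = x' 1 → x 2 = x' 2 → y x e₂ = y x' e₂ := by
    intro x x' h1 h3
    refine symbol_congr hy (R := ∅) (by simp) e₂ fun i hi => ?_
    fin_cases i
    exacts [(h2 hi).elim, h1, h3]
  have inj₁ : Function.Injective fun z : F => y ![1, 0, z] e₁ := by
    intro z z' hz
    have := sum_congr_of_terminal hy hdec (R := {e₁}) (x := ![1, 0, z]) (x' := ![1, 0, z'])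
      (by simpa using hz) 0 fun i hi => by
        fin_cases i
        exacts [rfl, rfl, (c2 hi).elim]
    simpa [Fin.sum_univ_three] using this
  have sum₂ : ∀ z₁ z₂ z₁' z₂' : F, y ![0, z₁, z₂] e₂ = y ![0, z₁', z₂'] e₂ →
      z₁ + z₂ = z₁' + z₂' := by
    intro z₁ z₂ z₁' z₂' hz
    have := sum_congr_of_terminal hy hdec (R := {e₂}) (x := ![0, z₁, z₂]) (x' := ![0, z₁', z₂'])
      (by simpa using hz) 1 fun i hi => by
        fin_cases i
        exacts [rfl, (c4.1 hi).elim, (c4.2 hi).elim]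
    simpa [Fin.sum_univ_three] using this
  have surj₂ : Function.Surjective fun z : F => y ![0, z, 0] e₂ :=
    Finite.surjective_of_injective fun z z' hz => by simpa using sum₂ _ _ _ _ hz
  -- On `e₁`, the choice x₂ = c compensates the change of x₀ from 0 to 1. On `e₂`, the symbol at (1,
  -- -c, c) also occurs at some (0, d, 0); since `e₂` determines x₁ + x₂, this d is 0.
  obtain ⟨c, hc⟩ := Finite.surjective_of_injective inj₁ (y 0 e₁)
  obtain ⟨d, hd⟩ := surj₂ (y ![1, -c, c] e₂)
  have hd' : y ![0, d, 0] e₂ = y ![0, -c, c] e₂ := hd.trans (congr₂ _ _ rfl rfl)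
  have hd0 : d = 0 := by simpa using sum₂ _ _ _ _ hd'
  have he₁ : y 0 e₁ = y ![1, -c, c] e₁ := hc.symm.trans (congr₁ _ _ rfl rfl)
  have he₂ : y 0 e₂ = y ![1, -c, c] e₂ := by
    rw [← hd, hd0]
    exact congr₂ _ _ rfl rfl
  have := sum_congr_of_terminal hy hdec (R := {e₁, e₂}) (x := 0) (x' := ![1, -c, c])
    (by rintro f (rfl | rfl) <;> assumption) 2 fun i hi => by
      fin_cases i
      exacts [(c1 (hi.mono (by simp))).elim, (c3 (hi.mono (by simp))).elim, (c5 hi).elim]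
  simp [Fin.sum_univ_three] at this

end Nonsolvable

theorem XORSolvableOver.solvableOver {V E S T : Type*} [DecidableEq V] [Fintype E] [Fintype S]
    {N : SumNetwork V E S T} {F : Type*} [Field F] (h : N.XORSolvableOver F) :
    N.SolvableOver F := by
  classical
  obtain ⟨a, b, c, y, -, -, -, hy, hd⟩ := h
  refine ⟨fun e p q => (∑ i, if h : N.source i = N.tail e then a i e * p ⟨i, h⟩ else 0) +
      ∑ f, if h : N.head f = N.tail e then b f e * q ⟨f, h⟩ else 0,
    fun j q => ∑ f, if h : N.head f = N.terminal j then c f j * q ⟨f, h⟩ else 0, y,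
    fun x e => ?_, fun x j => ?_⟩
  · rw [hy x e, Finset.sum_filter, Finset.sum_filter]
    simp
  · rw [← hd x j, Finset.sum_filter]
    simp

/-! ### XOR codes as integer coding vectors. -/

section Code

variable {V E : Type*} {N : SumNetwork V E (Fin 3) (Fin 3)}

/-- The node at which an input (a source symbol or an edge) is available. -/
def inputNode (N : SumNetwork V E (Fin 3) (Fin 3)) : Fin 3 ⊕ E → V := Sum.elim N.source N.head

/-- The global coding vector of an input, for the global coding vectors `g` of the edges. -/
def inputVec (g : E → Fin 3 → ℤ) : Fin 3 ⊕ E → Fin 3 → ℤ := Sum.elim (fun i => Pi.single i 1) g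

/-- The integer is a coefficient of an XOR code. -/
def IsSign (z : ℤ) : Prop := z = 0 ∨ z = 1 ∨ z = -1

theorem IsSign.zero : IsSign 0 := Or.inl rfl
theorem IsSign.one : IsSign 1 := Or.inr (Or.inl rfl)
theorem IsSign.neg_one : IsSign (-1) := Or.inr (Or.inr rfl)

variable [Fintype E]

/-- The vector `y` is available at the node `a`: it is a combination, with coefficients `0`, `1`
and `-1`, of the vectors of the inputs of `a`. -/
def Derivable (N : SumNetwork V E (Fin 3) (Fin 3)) (g : E → Fin 3 → ℤ) (a : V) (y : Fin 3 → ℤ) :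
    Prop :=
  ∃ c : Fin 3 ⊕ E → ℤ, (∀ k, IsSign (c k)) ∧ (∀ k, c k ≠ 0 → N.inputNode k = a) ∧
    y = ∑ k, c k • inputVec g k

variable {g : E → Fin 3 → ℤ} {a : V} {y y₁ y₂ : Fin 3 → ℤ}

theorem Derivable.zero : N.Derivable g a 0 :=
  ⟨0, fun _ => IsSign.zero, fun _ h => (h rfl).elim, by simp⟩

theorem derivable_input (k : Fin 3 ⊕ E) (hk : N.inputNode k = a) :
    N.Derivable g a (inputVec g k) := by
  classical
  refine ⟨Pi.single k 1, fun j => ?_, fun j hj => ?_, ?_⟩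
  · by_cases h : j = k
    · subst h; simpa using IsSign.one
    · simpa [h] using IsSign.zero
  · by_cases h : j = k
    · rw [h, hk]
    · simp [h] at hj
  · simp [Pi.single_apply]

theorem derivable_add_inputs {k k' : Fin 3 ⊕ E} (hkk : k ≠ k') (hk : N.inputNode k = a)
    (hk' : N.inputNode k' = a) : N.Derivable g a (inputVec g k + inputVec g k') := by
  classical
  refine ⟨Pi.single k 1 + Pi.single k' 1, fun j => ?_, fun j hj => ?_, ?_⟩
  · by_cases h : j = k
    · subst h; simpa [hkk] using IsSign.one
    · by_cases h' : j = k'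
      · subst h'; simpa [h] using IsSign.one
      · simpa [h, h'] using IsSign.zero
  · by_cases h : j = k
    · rw [h, hk]
    · by_cases h' : j = k'
      · rw [h', hk']
      · simp [h, h'] at hj
  · simp [Pi.single_apply, add_smul, Finset.sum_add_distrib]

theorem derivable_sub_inputs {k k' : Fin 3 ⊕ E} (hkk : k ≠ k') (hk : N.inputNode k = a)
    (hk' : N.inputNode k' = a) : N.Derivable g a (inputVec g k - inputVec g k') := by
  classical
  refine ⟨Pi.single k 1 - Pi.single k' 1, fun j => ?_, fun j hj => ?_, ?_⟩
  · by_cases h : j = k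
    · subst h; simpa [hkk] using IsSign.one
    · by_cases h' : j = k'
      · subst h'; simpa [h] using IsSign.neg_one
      · simpa [h, h'] using IsSign.zero
  · by_cases h : j = k
    · rw [h, hk]
    · by_cases h' : j = k'
      · rw [h', hk']
      · simp [h, h'] at hj
  · simp [Pi.single_apply, sub_smul, Finset.sum_sub_distrib]

theorem derivable_edge (f : E) (hf : N.head f = a) (hy : g f = y) : N.Derivable g a y :=
  hy ▸ derivable_input (g := g) (Sum.inr f) hf

theorem derivable_source (i : Fin 3) (hi : N.source i = a) :
    N.Derivable g a (Pi.single i 1) :=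
  derivable_input (g := g) (Sum.inl i) hi

open Classical in
/-- The sum of those of the symbols `y₁`, `y₂` that are present. -/
noncomputable def supportSum (A B : Prop) (y₁ y₂ : Fin 3 → ℤ) : Fin 3 → ℤ :=
  (if A then y₁ else 0) + (if B then y₂ else 0)

/-- If every symbol that is present at a node arrives either alone or together with another present
symbol, then the sum of the present symbols is available. -/
theorem derivable_supportSum {A B : Prop} (hy : y₁ ≠ y₂)
    (hA : A → ∃ k, N.inputNode k = a ∧ (inputVec g k = y₁ ∨ B ∧ inputVec g k = y₁ + y₂))
    (hB : B → ∃ k, N.inputNode k = a ∧ (inputVec g k = y₂ ∨ A ∧ inputVec g k = y₁ + y₂)) :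
    N.Derivable g a (supportSum A B y₁ y₂) := by
  unfold supportSum
  by_cases h₁ : A <;> by_cases h₂ : B <;> simp only [h₁, h₂, if_true, if_false, add_zero, zero_add]
  · obtain ⟨k, hk, hk' | ⟨-, hk'⟩⟩ := hA h₁
    · obtain ⟨l, hl, hl' | ⟨-, hl'⟩⟩ := hB h₂
      · rw [← hk', ← hl']
        refine derivable_add_inputs ?_ hk hl
        rintro rfl
        exact hy (hk'.symm.trans hl')
      · exact hl' ▸ derivable_input l hl
    · exact hk' ▸ derivable_input k hk
  · obtain ⟨k, hk, hk' | ⟨hB', -⟩⟩ := hA h₁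
    · exact hk' ▸ derivable_input k hk
    · exact (h₂ hB').elim
  · obtain ⟨k, hk, hk' | ⟨hA', -⟩⟩ := hB h₂
    · exact hk' ▸ derivable_input k hk
    · exact (h₁ hA').elim
  · exact Derivable.zero

theorem IsSign.cast {z : ℤ} (hz : IsSign z) (F : Type*) [Field F] :
    (z : F) = 0 ∨ (z : F) = 1 ∨ (z : F) = -1 := by
  rcases hz with rfl | rfl | rfl <;> simp

/-- An XOR code given by global coding vectors. -/
theorem xorSolvable_of_derivable [DecidableEq V] (g : E → Fin 3 → ℤ)
    (hg : ∀ f, N.Derivable g (N.tail f) (g f)) (ht : ∀ j, N.Derivable g (N.terminal j) 1) :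
    N.XORSolvableOverAllFields := by
  intro F _ _
  choose c hc₁ hc₂ hc₃ using hg
  choose d hd₁ hd₂ hd₃ using ht
  have expand : ∀ (c : Fin 3 ⊕ E → ℤ) (w : Fin 3 → ℤ) (x : Fin 3 → F),
      w = ∑ k, c k • inputVec g k →
      ∑ i, (w i : F) * x i = ∑ i, (c (Sum.inl i) : F) * x i +
        ∑ f, (c (Sum.inr f) : F) * ∑ i, (g f i : F) * x i := by
    rintro c w x rfl
    simp only [Fintype.sum_sum_type, inputVec, Sum.elim_inl, Sum.elim_inr,
      Finset.sum_apply, Pi.smul_apply, smul_eq_mul, Int.cast_add, Int.cast_sum, Int.cast_mul,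
      add_mul, Finset.sum_add_distrib, Finset.mul_sum, Finset.sum_mul]
    congr 1
    · simp [Pi.single_apply]
    · rw [Finset.sum_comm]
      simp only [mul_assoc]
  refine ⟨fun i e => c e (Sum.inl i), fun f e => c e (Sum.inr f), fun f j => d j (Sum.inr f),
    fun x e => ∑ i, (g e i : F) * x i, fun i e => (hc₁ e _).cast F, fun f e => (hc₁ e _).cast F,
    fun f j => (hd₁ j _).cast F, fun x e => ?_, fun x j => ?_⟩
  · refine (expand _ _ x (hc₃ e)).trans ?_
    congr 1
    · refine (Finset.sum_filter_of_ne fun i _ hi => hc₂ e (Sum.inl i) fun h => hi ?_).symm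
      simp [h]
    · refine (Finset.sum_filter_of_ne fun i _ hi => hc₂ e (Sum.inr i) fun h => hi ?_).symm
      simp [h]
  · have := expand _ _ x (hd₃ j)
    have hzero : ∀ i, d j (Sum.inl i) = 0 := fun i => by
      by_contra h
      exact N.source_ne_terminal i j (hd₂ j (Sum.inl i) h)
    simp only [Pi.one_apply, Int.cast_one, one_mul, hzero, Int.cast_zero, zero_mul,
      Finset.sum_const_zero, zero_add] at this
    rw [this]
    refine (Finset.sum_filter_of_ne fun i _ hi => hd₂ j (Sum.inr i) fun h => hi ?_)
    simp [h]

theorem XORSolvableOverAllFields.solvable [DecidableEq V] (h : N.XORSolvableOverAllFields) :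
    N.Solvable :=
  haveI : Fact (Nat.Prime 2) := ⟨Nat.prime_two⟩
  ⟨ZMod 2, inferInstance, inferInstance, (h (ZMod 2)).solvableOver⟩

end Code

/-! ### Invariance under relabeling of sources and terminals. -/

section Relabel

variable {V E : Type*}

/-- The network with the sources and terminals relabeled. -/
def relabel (N : SumNetwork V E (Fin 3) (Fin 3)) (σ τ : Equiv.Perm (Fin 3)) :
    SumNetwork V E (Fin 3) (Fin 3) where
  tail := N.tail
  head := N.head
  acyclic := N.acyclic
  source := N.source ∘ σ
  terminal := N.terminal ∘ τ
  source_injective := N.source_injective.comp σ.injective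
  terminal_injective := N.terminal_injective.comp τ.injective
  source_ne_terminal _ _ := N.source_ne_terminal _ _

variable {N : SumNetwork V E (Fin 3) (Fin 3)} {σ τ : Equiv.Perm (Fin 3)}

theorem XORSolvableOverAllFields.of_relabel [DecidableEq V] [Fintype E]
    (h : (N.relabel σ τ).XORSolvableOverAllFields) : N.XORSolvableOverAllFields := by
  intro F _ _
  obtain ⟨a, b, c, y, ha, hb, hc, hy, hd⟩ := h F
  refine ⟨fun i => a (σ.symm i), b, fun f j => c f (τ.symm j), fun x => y (x ∘ σ),
    fun i => ha _, hb, fun f j => hc _ _, fun x e => ?_, fun x j => ?_⟩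
  · refine (hy (x ∘ σ) e).trans ?_
    congr 1
    rw [Finset.sum_filter, Finset.sum_filter,
      ← Equiv.sum_comp σ fun i => if N.source i = N.tail e then a (σ.symm i) e * x i else 0]
    simp only [Equiv.symm_apply_apply]
    exact Finset.sum_congr rfl fun i _ => if_congr Iff.rfl rfl rfl
  · have := hd (x ∘ σ) (τ.symm j)
    simp only [relabel, Function.comp_apply, Equiv.apply_symm_apply] at this
    exact this.trans (Equiv.sum_comp σ x)

theorem Solvable.relabel (h : N.Solvable) : (N.relabel σ τ).Solvable := by
  obtain ⟨F, i₁, i₂, enc, dec, y, hy, hd⟩ := h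
  refine ⟨F, i₁, i₂, fun e p q => enc e (fun i => p ⟨σ.symm i, ?_⟩) q, fun j => dec (τ j),
    fun x => y (x ∘ σ.symm), fun x e => hy _ e, fun x j => (hd _ (τ j)).trans ?_⟩
  · simpa [SumNetwork.relabel] using i.2
  · exact Equiv.sum_comp σ.symm x

end Relabel

/-! ### Routing sums of symbols along forests. -/

section Forest

variable {V E : Type*} {N : SumNetwork V E (Fin 3) (Fin 3)} {n : V → Option E} {Z : Set E}

/-- The node `a` is met when one starts at the node `r` and follows the chosen edges `n`. -/
def OnOrbit (N : SumNetwork V E (Fin 3) (Fin 3)) (n : V → Option E) : V → V → Prop :=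
  Relation.ReflTransGen fun a b => ∃ f, n a = some f ∧ N.head f = b

theorem OnOrbit.reach (hn : ∀ a f, n a = some f → N.tail f = a ∧ f ∈ Z) {r a : V}
    (h : N.OnOrbit n r a) : N.Reach Zᶜ r a := by
  induction h with
  | refl => exact Reach.refl _ _ _
  | tail _ hbc ih =>
    obtain ⟨f, hf, rfl⟩ := hbc
    have := hn _ _ hf
    exact Reach.snoc (this.1 ▸ ih) (by simpa using this.2)

/-- An orbit is a path in an acyclic graph, so it enters each node by only one of its edges. This
keeps an input from being counted twice. -/
theorem OnOrbit.edge_unique (hn : ∀ a f, n a = some f → N.tail f = a ∧ f ∈ Z) {r : V} {f f' : E}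
    (h : N.OnOrbit n r (N.tail f)) (h' : N.OnOrbit n r (N.tail f')) (hf : n (N.tail f) = some f)
    (hf' : n (N.tail f') = some f') (hh : N.head f = N.head f') : f = f' := by
  have aux : ∀ {f f' : E}, n (N.tail f) = some f → N.head f = N.head f' →
      N.OnOrbit n (N.tail f) (N.tail f') → N.tail f = N.tail f' := by
    intro f f' hf hh h
    rcases Relation.ReflTransGen.cases_head h with h | ⟨c, ⟨e, he, rfl⟩, hc⟩
    · exact h
    · obtain rfl : e = f := by simpa [he] using hf
      have := OnOrbit.reach hn hc
      rw [hh] at this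
      exact this.not_back.elim
  have htail : N.tail f = N.tail f' := by
    rcases Relation.ReflTransGen.total_of_right_unique
      (fun a b c ⟨e, he, hb⟩ ⟨e', he', hc⟩ => by
        obtain rfl : e = e' := by simpa [he] using he'
        exact hb.symm.trans hc) h h' with h | h
    · exact aux hf hh h
    · exact (aux hf' hh.symm h).symm
  rw [htail, hf'] at hf
  exact (Option.some.inj hf).symm

variable [Fintype E] {c : Fin 3 ⊕ E → ℤ} {G : E → Fin 3 → ℤ}

open Classical in
/-- The sum, with coefficients `c`, of the vectors of those inputs that are routed through `a` by
the chosen edges. -/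
noncomputable def orbitSum (N : SumNetwork V E (Fin 3) (Fin 3)) (n : V → Option E)
    (c : Fin 3 ⊕ E → ℤ) (G : E → Fin 3 → ℤ) (a : V) : Fin 3 → ℤ :=
  ∑ k, if N.OnOrbit n (N.inputNode k) a then c k • inputVec G k else 0

-- An input routed through `a` either sits at `a` or arrives over exactly one chosen edge;
-- acyclicity excludes both at once.
open Classical in
theorem orbitSum_eq (hn : ∀ a f, n a = some f → N.tail f = a ∧ f ∈ Z) (a : V) :
    N.orbitSum n c G a = (∑ k, if N.inputNode k = a then c k • inputVec G k else 0) +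
      ∑ f, if N.head f = a ∧ n (N.tail f) = some f then N.orbitSum n c G (N.tail f) else 0 := by
  have hswap : (∑ f, if N.head f = a ∧ n (N.tail f) = some f then N.orbitSum n c G (N.tail f)
      else 0) = ∑ k, ∑ f, if (N.head f = a ∧ n (N.tail f) = some f) ∧
        N.OnOrbit n (N.inputNode k) (N.tail f) then c k • inputVec G k else 0 := by
    rw [Finset.sum_comm]
    refine Finset.sum_congr rfl fun f _ => ?_
    by_cases h : N.head f = a ∧ n (N.tail f) = some f
    · simp [h, orbitSum]
    · simp only [h, if_false, false_and, Finset.sum_const_zero]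
  rw [hswap, ← Finset.sum_add_distrib]
  refine Finset.sum_congr rfl fun k _ => ?_
  by_cases hk : N.inputNode k = a
  · rw [if_pos hk, if_pos (by rw [hk]; exact Relation.ReflTransGen.refl), Finset.sum_eq_zero,
      add_zero]
    rintro f -
    refine if_neg ?_
    rintro ⟨⟨hf, -⟩, ho⟩
    have := ho.reach hn
    rw [hk, ← hf] at this
    exact this.not_back
  · rw [if_neg hk, zero_add]
    by_cases ho : N.OnOrbit n (N.inputNode k) a
    · rw [if_pos ho]
      rcases Relation.ReflTransGen.cases_tail ho with h | ⟨b, hb, f, hf, hfa⟩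
      · exact (hk h.symm).elim
      · obtain rfl : N.tail f = b := (hn _ _ hf).1
        rw [Finset.sum_eq_single f, if_pos ⟨⟨hfa, hf⟩, hb⟩]
        · rintro f' - hne
          refine if_neg ?_
          rintro ⟨⟨hf', hf''⟩, ho'⟩
          exact hne (ho'.edge_unique hn hb hf'' hf (hf'.trans hfa.symm))
        · simp
    · rw [if_neg ho, Finset.sum_eq_zero]
      rintro f -
      refine if_neg ?_
      rintro ⟨⟨hf, hf'⟩, ho'⟩
      exact ho (Relation.ReflTransGen.tail ho' ⟨f, hf', hf⟩)

/-- The node adds its own inputs and the chosen edges entering it. Chosen edges lie in `Z`, where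
`c` vanishes, so coefficients never collide. Edges with `tv f = 0` are not used, which leaves them
free to carry another symbol. -/
theorem derivable_orbitSum (hn : ∀ a f, n a = some f → N.tail f = a ∧ f ∈ Z)
    (hc : ∀ k, IsSign (c k)) (hcZ : ∀ f ∈ Z, c (Sum.inr f) = 0) {G₀ tv : E → Fin 3 → ℤ}
    (hG : ∀ f ∉ Z, G f = G₀ f) (hG' : ∀ f ∈ Z, tv f ≠ 0 → G f = tv f)
    (htv : ∀ f, n (N.tail f) = some f → N.orbitSum n c G₀ (N.tail f) = tv f) (a : V) :
    N.Derivable G a (N.orbitSum n c G₀ a) := by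
  classical
  let d : E → ℤ := fun f => if N.head f = a ∧ n (N.tail f) = some f ∧ tv f ≠ 0 then 1 else 0
  refine ⟨fun k => (if N.inputNode k = a then c k else 0) + Sum.elim (fun _ => 0) d k,
    ?_, ?_, ?_⟩
  · rintro (i | f)
    · by_cases h : N.inputNode (Sum.inl i) = a
      · simpa [h] using hc _
      · simpa [h] using IsSign.zero
    · by_cases hf : f ∈ Z
      · by_cases h : N.head f = a ∧ n (N.tail f) = some f ∧ tv f ≠ 0
        · simpa [hcZ f hf, d, h] using IsSign.one
        · simpa only [hcZ f hf, d, h, if_false, Sum.elim_inr, ite_self, add_zero] using IsSign.zero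
      · have h : ¬ (N.head f = a ∧ n (N.tail f) = some f ∧ tv f ≠ 0) :=
          fun h => hf (hn _ _ h.2.1).2
        by_cases h' : N.inputNode (Sum.inr f) = a
        · simpa only [d, h, h', if_false, if_true, Sum.elim_inr, add_zero] using hc _
        · simpa only [d, h, h', if_false, Sum.elim_inr, add_zero] using IsSign.zero
  · rintro k hk
    by_contra hka
    rcases k with i | f
    · simp [hka] at hk
    · have : ¬ N.head f = a := hka
      simp [hka, d, this] at hk
  · rw [orbitSum_eq hn a, Fintype.sum_sum_type, Fintype.sum_sum_type, add_assoc]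
    congr 1
    · refine Finset.sum_congr rfl fun i _ => ?_
      simp [inputVec, ite_smul]
    · rw [← Finset.sum_add_distrib]
      refine Finset.sum_congr rfl fun f _ => ?_
      have h₁ : (if N.inputNode (Sum.inr f) = a then c (Sum.inr f) • inputVec G₀ (Sum.inr f) else 0)
          = (if N.inputNode (Sum.inr f) = a then c (Sum.inr f) else 0) • G f := by
        by_cases hf : f ∈ Z
        · simp [hcZ f hf]
        · simp [inputVec, hG f hf, ite_smul]
      have h₂ : (if N.head f = a ∧ n (N.tail f) = some f then N.orbitSum n c G₀ (N.tail f) else 0)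
          = d f • G f := by
        by_cases h : N.head f = a ∧ n (N.tail f) = some f
        · rw [if_pos h, htv f h.2]
          by_cases h' : tv f = 0
          · simp [d, h']
          · simp only [d, h, h', ne_eq, not_false_eq_true, and_self, if_true, one_smul]
            exact (hG' f (hn _ _ h.2).2 h').symm
        · rw [if_neg h, show d f = 0 from if_neg fun h' => h ⟨h'.1, h'.2.1⟩, zero_smul]
      rw [h₁, h₂]
      simp only [inputVec, Sum.elim_inr, add_smul]

omit [Fintype E] in
/-- Next edges towards two nodes `p` and `q`, which agree as long as possible. -/
theorem exists_nextEdges (N : SumNetwork V E (Fin 3) (Fin 3)) (Z : Set E) (p q : V) :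
    ∃ np nq : V → Option E,
      (∀ a f, np a = some f → N.tail f = a ∧ f ∈ Z ∧ N.Reach Zᶜ (N.head f) p) ∧
      (∀ a f, nq a = some f → N.tail f = a ∧ f ∈ Z ∧ N.Reach Zᶜ (N.head f) q) ∧
      (∀ a, N.Reach Zᶜ a p → a ≠ p → ∃ f, np a = some f) ∧
      (∀ a, N.Reach Zᶜ a q → a ≠ q → ∃ f, nq a = some f) ∧
      (∀ a f, np a = some f → N.Reach Zᶜ (N.head f) q → nq a = some f) ∧
      (∀ a f, nq a = some f → N.Reach Zᶜ (N.head f) p → np a = some f) := by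
  classical
  -- An edge towards both targets has priority, and it is picked by a choice that does not depend on
  -- the target. So a chosen edge leading to both is chosen for both.
  let C : V → E → Prop := fun a f =>
    f ∈ Z ∧ N.tail f = a ∧ N.Reach Zᶜ (N.head f) p ∧ N.Reach Zᶜ (N.head f) q
  let P : V → V → E → Prop := fun p a f => f ∈ Z ∧ N.tail f = a ∧ N.Reach Zᶜ (N.head f) p
  let nx : V → V → Option E := fun p a => if h : ∃ f, C a f then some h.choose else
    if h : ∃ f, P p a f then some h.choose else none
  have h₁ : ∀ r, r = p ∨ r = q → ∀ a f, nx r a = some f →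
      N.tail f = a ∧ f ∈ Z ∧ N.Reach Zᶜ (N.head f) r := by
    intro r hr a f hf
    by_cases h : ∃ f, C a f
    · simp only [nx, h, dif_pos, Option.some.injEq] at hf
      obtain ⟨k₁, k₂, k₃, k₄⟩ := h.choose_spec
      rw [hf] at k₁ k₂ k₃ k₄
      refine ⟨k₂, k₁, ?_⟩
      rcases hr with rfl | rfl <;> assumption
    · by_cases h' : ∃ f, P r a f
      · simp only [nx, h, h', dif_pos, dif_neg, not_false_eq_true, Option.some.injEq] at hf
        obtain ⟨k₁, k₂, k₃⟩ := h'.choose_spec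
        rw [hf] at k₁ k₂ k₃
        exact ⟨k₂, k₁, k₃⟩
      · simp [nx, h, h'] at hf
  have h₂ : ∀ r a, N.Reach Zᶜ a r → a ≠ r → ∃ f, nx r a = some f := by
    intro r a har hne
    obtain ⟨f, hf, rfl, hfr⟩ := har.cases_cons.resolve_left hne
    have h' : ∃ g, P r (N.tail f) g := ⟨f, by simpa using hf, rfl, hfr⟩
    by_cases h : ∃ g, C (N.tail f) g
    · exact ⟨_, dif_pos h⟩
    · exact ⟨_, (dif_neg h).trans (dif_pos h')⟩
  have h₃ : ∀ r r' a f, C a f → nx r a = nx r' a := by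
    intro r r' a f hf
    have h : ∃ f, C a f := ⟨f, hf⟩
    simp only [nx, h, dif_pos]
  refine ⟨nx p, nx q, h₁ p (Or.inl rfl), h₁ q (Or.inr rfl), h₂ p, h₂ q, fun a f hf hfq => ?_,
    fun a f hf hfp => ?_⟩
  · obtain ⟨k₁, k₂, k₃⟩ := h₁ p (Or.inl rfl) a f hf
    rw [h₃ q p a f ⟨k₂, k₁, k₃, hfq⟩, hf]
  · obtain ⟨k₁, k₂, k₃⟩ := h₁ q (Or.inr rfl) a f hf
    rw [h₃ p q a f ⟨k₂, k₁, hfp, k₃⟩, hf]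

/-- Every chosen edge still leads to `p`, so the orbit can stop only at `p`, and acyclicity with
finitely many edges makes it stop. -/
theorem onOrbit_of_reach {p : V} (hn : ∀ a f, n a = some f → N.tail f = a ∧ N.Reach Zᶜ (N.head f) p)
    (hn' : ∀ a, N.Reach Zᶜ a p → a ≠ p → ∃ f, n a = some f) {a : V} (ha : N.Reach Zᶜ a p) :
    N.OnOrbit n a p := by
  have step : ∀ a, N.Reach Zᶜ a p →
      (∀ f, N.tail f = a → N.Reach Zᶜ (N.head f) p → N.OnOrbit n (N.head f) p) →
      N.OnOrbit n a p := by
    intro a ha h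
    by_cases hap : a = p
    · exact hap ▸ Relation.ReflTransGen.refl
    · obtain ⟨f, hf⟩ := hn' a ha hap
      exact Relation.ReflTransGen.head ⟨f, hf, rfl⟩ (h f (hn a f hf).1 (hn a f hf).2)
  suffices H : ∀ f, N.Reach Zᶜ (N.head f) p → N.OnOrbit n (N.head f) p from
    step a ha fun f _ => H f
  intro f
  induction f using N.wellFounded_edgeReach_swap.induction with
  | _ f ih =>
  intro hf
  refine step _ hf fun f' hf' => ih f' ?_
  unfold EdgeReach
  rw [hf']
  exact Reach.refl _ _ _

-- If the end of an orbit leads to `q`, so does every edge on the way, and there `n` and `n'` choose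
-- alike.
omit [Fintype E] in
theorem OnOrbit.congr {n' : V → Option E} {q : V}
    (h : ∀ a f, n a = some f → N.Reach Zᶜ (N.head f) q → n' a = some f)
    (hn : ∀ a f, n a = some f → N.tail f = a ∧ f ∈ Z)
    {r a : V} (hra : N.OnOrbit n r a) (ha : N.Reach Zᶜ a q) : N.OnOrbit n' r a := by
  induction hra with
  | refl => exact Relation.ReflTransGen.refl
  | tail _ hbc ih =>
    obtain ⟨f, hf, rfl⟩ := hbc
    obtain ⟨rfl, hfZ⟩ := hn _ _ hf
    exact Relation.ReflTransGen.tail (ih (Reach.cons (by simpa using hfZ) ha)) ⟨f, h _ _ hf ha, rfl⟩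

open Classical in
/-- Route inputs to two nodes `p` and `q` along the edges of `Z`, with coefficients `cp` for those
that `p` needs and `cq` for those that `q` needs. -/
theorem exists_forest_code (N : SumNetwork V E (Fin 3) (Fin 3)) (Z : Set E) (p q : V)
    (cp cq : Fin 3 ⊕ E → ℤ) (hcp : ∀ k, IsSign (cp k)) (hcq : ∀ k, IsSign (cq k))
    (hpZ : ∀ f ∈ Z, cp (Sum.inr f) = 0) (hqZ : ∀ f ∈ Z, cq (Sum.inr f) = 0)
    (hp : ∀ k, cp k ≠ 0 → N.Reach Zᶜ (N.inputNode k) p)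
    (hq : ∀ k, cq k ≠ 0 → N.Reach Zᶜ (N.inputNode k) q)
    (hpq : ∀ k, N.Reach Zᶜ (N.inputNode k) p → N.Reach Zᶜ (N.inputNode k) q → cp k = cq k)
    (G₀ : E → Fin 3 → ℤ) :
    ∃ tv : E → Fin 3 → ℤ,
      (∀ f, tv f ≠ 0 → N.Reach Zᶜ (N.head f) p ∨ N.Reach Zᶜ (N.head f) q) ∧
      (∀ f, ∃ B : Set V, (∀ b ∈ B, N.Reach Zᶜ b (N.tail f)) ∧
        (tv f = (∑ k, if N.inputNode k ∈ B then cp k • inputVec G₀ k else 0) ∨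
          tv f = ∑ k, if N.inputNode k ∈ B then cq k • inputVec G₀ k else 0)) ∧
      ∀ G : E → Fin 3 → ℤ, (∀ f ∉ Z, G f = G₀ f) → (∀ f ∈ Z, tv f ≠ 0 → G f = tv f) →
        (∀ f, N.Derivable G (N.tail f) (tv f)) ∧
        N.Derivable G p (∑ k, cp k • inputVec G₀ k) ∧
        N.Derivable G q (∑ k, cq k • inputVec G₀ k) := by
  obtain ⟨np, nq, hnp, hnq, hnp', hnq', hpq₁, hpq₂⟩ := N.exists_nextEdges Z p q
  have hnp₀ : ∀ a f, np a = some f → N.tail f = a ∧ f ∈ Z :=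
    fun a f h => ⟨(hnp a f h).1, (hnp a f h).2.1⟩
  have hnq₀ : ∀ a f, nq a = some f → N.tail f = a ∧ f ∈ Z :=
    fun a f h => ⟨(hnq a f h).1, (hnq a f h).2.1⟩
  -- Where both targets can still be reached, the two routings have the same orbits and the same
  -- coefficients, so an edge chosen by both carries one well-defined symbol.
  have hYY : ∀ a, N.Reach Zᶜ a p → N.Reach Zᶜ a q →
      N.orbitSum np cp G₀ a = N.orbitSum nq cq G₀ a := by
    intro a hap haq
    refine Finset.sum_congr rfl fun k _ => ?_
    have hiff : N.OnOrbit np (N.inputNode k) a ↔ N.OnOrbit nq (N.inputNode k) a :=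
      ⟨fun h => h.congr hpq₁ hnp₀ haq, fun h => h.congr hpq₂ hnq₀ hap⟩
    by_cases h : N.OnOrbit np (N.inputNode k) a
    · have hr := h.reach hnp₀
      rw [if_pos h, if_pos (hiff.1 h), hpq k (hr.trans hap) (hr.trans haq)]
    · rw [if_neg h, if_neg (fun h' => h (hiff.2 h'))]
  let tv : E → Fin 3 → ℤ := fun f =>
    if np (N.tail f) = some f then N.orbitSum np cp G₀ (N.tail f) else
      if nq (N.tail f) = some f then N.orbitSum nq cq G₀ (N.tail f) else 0
  have htp : ∀ f, np (N.tail f) = some f → N.orbitSum np cp G₀ (N.tail f) = tv f :=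
    fun f hf => (if_pos hf).symm
  have htq : ∀ f, nq (N.tail f) = some f → N.orbitSum nq cq G₀ (N.tail f) = tv f := by
    intro f hf
    by_cases hf' : np (N.tail f) = some f
    · rw [← htp f hf']
      obtain ⟨-, hZ, hfp⟩ := hnp _ _ hf'
      obtain ⟨-, -, hfq⟩ := hnq _ _ hf
      exact (hYY _ (Reach.cons (by simpa using hZ) hfp) (Reach.cons (by simpa using hZ) hfq)).symm
    · simp only [tv, hf, hf', if_true, if_false]
  have total : ∀ (c : Fin 3 ⊕ E → ℤ) (n : V → Option E) (r : V),
      (∀ k, c k ≠ 0 → N.OnOrbit n (N.inputNode k) r) →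
      N.orbitSum n c G₀ r = ∑ k, c k • inputVec G₀ k := by
    intro c n r h
    refine Finset.sum_congr rfl fun k _ => ?_
    by_cases hk : c k = 0
    · simp [hk]
    · rw [if_pos (h k hk)]
  have tp := total cp np p fun k hk => onOrbit_of_reach
    (fun a f h => ⟨(hnp a f h).1, (hnp a f h).2.2⟩) hnp' (hp k hk)
  have tq := total cq nq q fun k hk => onOrbit_of_reach
    (fun a f h => ⟨(hnq a f h).1, (hnq a f h).2.2⟩) hnq' (hq k hk)
  refine ⟨tv, fun f hf => ?_, fun f => ?_, fun G hG hG' => ⟨fun f => ?_, ?_, ?_⟩⟩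
  · by_cases h : np (N.tail f) = some f
    · exact Or.inl (hnp _ _ h).2.2
    · by_cases h' : nq (N.tail f) = some f
      · exact Or.inr (hnq _ _ h').2.2
      · simp [tv, h, h'] at hf
  · by_cases h : np (N.tail f) = some f
    · exact ⟨{b | N.OnOrbit np b (N.tail f)}, fun b hb => OnOrbit.reach hnp₀ hb,
        Or.inl (htp f h).symm⟩
    · by_cases h' : nq (N.tail f) = some f
      · exact ⟨{b | N.OnOrbit nq b (N.tail f)}, fun b hb => OnOrbit.reach hnq₀ hb,
          Or.inr (htq f h').symm⟩
      · exact ⟨∅, by simp, Or.inl (by simp [tv, h, h'])⟩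
  · by_cases h : np (N.tail f) = some f
    · rw [← htp f h]
      exact derivable_orbitSum hnp₀ hcp hpZ hG hG' htp _
    · by_cases h' : nq (N.tail f) = some f
      · rw [← htq f h']
        exact derivable_orbitSum hnq₀ hcq hqZ hG hG' htq _
      · rw [show tv f = 0 by simp [tv, h, h']]
        exact Derivable.zero
  · rw [← tp]
    exact derivable_orbitSum hnp₀ hcp hpZ hG hG' htp _
  · rw [← tq]
    exact derivable_orbitSum hnq₀ hcq hqZ hG hG' htq _

end Forest

/-! ### The two cases with a common place to form the sum. -/

section Easy

variable {V E : Type*} [Fintype E] {N : SumNetwork V E (Fin 3) (Fin 3)}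

theorem single_one_ne {i j : Fin 3} (h : i ≠ j) :
    (Pi.single i 1 : Fin 3 → ℤ) ≠ Pi.single j 1 := fun h' => by
  have := congrFun h' i
  simp [h] at this

theorem sum_single_one : (∑ i : Fin 3, Pi.single i 1 : Fin 3 → ℤ) = 1 := by
  ext j
  simp [Pi.single_apply]

/-- The sources can all reach the edge `e`, and `e` can reach two of the terminals. -/
theorem xorSolvable_of_sum_edge [DecidableEq V] (hconn : N.Connected) {e : E}
    (hs : ∀ i, N.Reach ∅ (N.source i) (N.tail e)) (h₁ : N.Reach ∅ (N.head e) (N.terminal 1))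
    (h₂ : N.Reach ∅ (N.head e) (N.terminal 2)) : N.XORSolvableOverAllFields := by
  classical
  let D : V → Prop := fun a => N.Reach ∅ (N.head e) a
  let Z : Set E := {f | ¬ D (N.tail f) ∧ f ≠ e}
  have hu : ¬ D (N.tail e) := fun h => h.not_back
  have hZ : ∀ {a b}, N.Reach ∅ a b → ¬ D b → N.Reach Zᶜ a b := by
    intro a b h hb
    refine h.restrict fun f _ _ hf => ?_
    simp only [Set.mem_compl_iff, not_not]
    refine ⟨fun hD => hb (Reach.trans hD (Reach.cons (Set.notMem_empty f) hf)), ?_⟩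
    rintro rfl
    exact hb hf
  -- Terminal 0 is a second target only if it is not behind `e`; otherwise the tail of `e` is taken
  -- twice.
  obtain ⟨q, hq, hqs, hqt⟩ : ∃ q, ¬ D q ∧ (∀ i, N.Reach ∅ (N.source i) q) ∧
      (D (N.terminal 0) ∨ q = N.terminal 0) := by
    by_cases h : D (N.terminal 0)
    · exact ⟨_, hu, hs, Or.inl h⟩
    · exact ⟨_, h, fun i => hconn i 0, Or.inr rfl⟩
  let c : Fin 3 ⊕ E → ℤ := Sum.elim (fun _ => 1) fun _ => 0
  have hc : ∀ k, IsSign (c k) := by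
    rintro (i | f)
    exacts [IsSign.one, IsSign.zero]
  obtain ⟨tv, -, -, htv⟩ := N.exists_forest_code Z (N.tail e) q c c hc hc (fun _ _ => rfl)
    (fun _ _ => rfl) (by
      rintro (i | f) hk
      exacts [hZ (hs i) hu, (hk rfl).elim]) (by
      rintro (i | f) hk
      exacts [hZ (hqs i) hq, (hk rfl).elim]) (fun _ _ _ => rfl) 1
  have hsum : ∑ k, c k • inputVec (1 : E → Fin 3 → ℤ) k = 1 := by
    rw [Fintype.sum_sum_type]
    simp [c, inputVec, sum_single_one]
  rw [hsum] at htv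
  let G : E → Fin 3 → ℤ := fun f => if f ∈ Z then tv f else 1
  obtain ⟨hG₁, hG₂, hG₃⟩ := htv G (fun f hf => if_neg hf) (fun f hf _ => if_pos hf)
  have hD : ∀ a, D a → N.Derivable G a 1 := by
    intro a ha
    rcases Reach.cases_snoc ha with rfl | ⟨f, -, hf, rfl⟩
    · exact derivable_edge e rfl (if_neg fun h => h.2 rfl)
    · exact derivable_edge f rfl (if_neg fun h => h.1 hf)
  refine xorSolvable_of_derivable G (fun f => ?_) fun j => ?_
  · by_cases hf : f ∈ Z
    · rw [show G f = tv f from if_pos hf]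
      exact hG₁ f
    · rw [show G f = 1 from if_neg hf]
      by_cases hfD : D (N.tail f)
      · exact hD _ hfD
      · obtain rfl : f = e := by
          by_contra h
          exact hf ⟨hfD, h⟩
        exact hG₂
  · fin_cases j
    · rcases hqt with h | rfl
      exacts [hD _ h, hG₃]
    · exact hD _ h₁
    · exact hD _ h₂

/-- Two of the sources, but not the third, can reach the node `w`, and `w` can reach all the
terminals. -/
theorem xorSolvable_of_pair_node [DecidableEq V] (hconn : N.Connected) {w : V}
    (h₀ : ¬ N.Reach ∅ (N.source 0) w) (h₁ : N.Reach ∅ (N.source 1) w)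
    (h₂ : N.Reach ∅ (N.source 2) w) (ht : ∀ j, N.Reach ∅ w (N.terminal j)) :
    N.XORSolvableOverAllFields := by
  classical
  let x : Fin 3 → Fin 3 → ℤ := fun i => Pi.single i 1
  let S : Fin 3 → V → Prop := fun i a => N.Reach ∅ (N.source i) a
  have snoc : ∀ {a f}, N.Reach ∅ a (N.tail f) → N.Reach ∅ a (N.head f) :=
    fun h => h.snoc (Set.notMem_empty _)
  -- Edges leading to `w` collect whichever of x₁, x₂ has arrived. All other edges treat x₁ + x₂,
  -- released at `w`, as a single symbol beside x₀.
  let G : E → Fin 3 → ℤ := fun f => if N.Reach ∅ (N.head f) w then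
    supportSum (S 1 (N.tail f)) (S 2 (N.tail f)) (x 1) (x 2) else
    supportSum (N.Reach ∅ w (N.tail f)) (S 0 (N.tail f)) (x 1 + x 2) (x 0)
  have hbefore : ∀ a, N.Reach ∅ a w →
      N.Derivable G a (supportSum (S 1 a) (S 2 a) (x 1) (x 2)) := by
    intro a ha
    refine derivable_supportSum (single_one_ne (by decide)) (fun hA => ?_) fun hB => ?_
    · rcases Reach.cases_snoc hA with rfl | ⟨f, -, hf, rfl⟩
      · exact ⟨Sum.inl 1, rfl, Or.inl rfl⟩
      · refine ⟨Sum.inr f, rfl, ?_⟩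
        have hf' : S 1 (N.tail f) := hf
        by_cases h : S 2 (N.tail f)
        · exact Or.inr ⟨snoc h, by simp [inputVec, G, ha, supportSum, hf', h]⟩
        · exact Or.inl (by simp [inputVec, G, ha, supportSum, hf', h])
    · rcases Reach.cases_snoc hB with rfl | ⟨f, -, hf, rfl⟩
      · exact ⟨Sum.inl 2, rfl, Or.inl rfl⟩
      · refine ⟨Sum.inr f, rfl, ?_⟩
        have hf' : S 2 (N.tail f) := hf
        by_cases h : S 1 (N.tail f)
        · exact Or.inr ⟨snoc h, by simp [inputVec, G, ha, supportSum, hf', h]⟩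
        · exact Or.inl (by simp [inputVec, G, ha, supportSum, hf', h])
  have hafter : ∀ a, ¬ N.Reach ∅ a w →
      N.Derivable G a (supportSum (N.Reach ∅ w a) (S 0 a) (x 1 + x 2) (x 0)) := by
    intro a ha
    have hne : x 1 + x 2 ≠ x 0 := fun h => by
      have := congrFun h 0
      simp [x] at this
    refine derivable_supportSum hne (fun hA => ?_) fun hB => ?_
    · rcases Reach.cases_snoc hA with rfl | ⟨f, -, hf, rfl⟩
      · exact (ha (Reach.refl _ _ _)).elim
      · refine ⟨Sum.inr f, rfl, ?_⟩
        by_cases h : S 0 (N.tail f)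
        · exact Or.inr ⟨snoc h, by simp [inputVec, G, ha, supportSum, hf, h]⟩
        · exact Or.inl (by simp [inputVec, G, ha, supportSum, hf, h])
    · rcases Reach.cases_snoc hB with rfl | ⟨f, -, hf, rfl⟩
      · exact ⟨Sum.inl 0, rfl, Or.inl rfl⟩
      · refine ⟨Sum.inr f, rfl, ?_⟩
        have hf' : S 0 (N.tail f) := hf
        by_cases h : N.Reach ∅ w (N.tail f)
        · exact Or.inr ⟨snoc h, by simp [inputVec, G, ha, supportSum, hf', h]⟩
        · exact Or.inl (by simp [inputVec, G, ha, supportSum, hf', h])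
  refine xorSolvable_of_derivable G (fun f => ?_) fun j => ?_
  · by_cases hf : N.Reach ∅ (N.head f) w
    · rw [show G f = _ from if_pos hf]
      exact hbefore _ (hf.cons (Set.notMem_empty f))
    · rw [show G f = _ from if_neg hf]
      by_cases ha : N.Reach ∅ (N.tail f) w
      · have h0 : ¬ S 0 (N.tail f) := fun h => h₀ (Reach.trans h ha)
        by_cases hw : N.Reach ∅ w (N.tail f)
        · have := hbefore _ ha
          -- Here the tail is `w` itself, where the two rules meet.
          have ha' := ha.antisymm hw
          have k₁ : S 1 (N.tail f) := by rw [ha']; exact h₁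
          have k₂ : S 2 (N.tail f) := by rw [ha']; exact h₂
          simpa [supportSum, h0, hw, k₁, k₂] using this
        · simpa [supportSum, h0, hw] using Derivable.zero
      · exact hafter _ ha
  · have hj : ¬ N.Reach ∅ (N.terminal j) w := fun h => h₀ ((hconn 0 j).trans h)
    have := hafter _ hj
    have h0 : S 0 (N.terminal j) := hconn 0 j
    rw [← sum_single_one, Fin.sum_univ_three]
    simpa [supportSum, h0, ht j, x, add_comm, add_left_comm, add_assoc] using this

end Easy

/-! ### Menger's theorem for two edge-disjoint paths from one node. -/

section Menger

variable {V E S T : Type*} {N : SumNetwork V E S T} {R R' : Set E} {m a b : V} {f f' g h h₁ h₂ : E}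

/-- There is a path from the node `m` through the edge `f`. -/
def ReachEdge (N : SumNetwork V E S T) (R : Set E) (m : V) (f : E) : Prop :=
  f ∉ R ∧ N.Reach R m (N.tail f)

theorem ReachEdge.mono (hR : R ⊆ R') (hf : N.ReachEdge R' m f) : N.ReachEdge R m f :=
  ⟨fun h => hf.1 (hR h), hf.2.mono hR⟩

theorem ReachEdge.of_cut (hf : N.ReachEdge R m f) (hh : ¬ N.ReachEdge (insert h R) m f) :
    h = f ∨ (h ∉ R ∧ N.Reach (insert h R) m (N.tail h) ∧
      N.Reach (insert h R) (N.head h) (N.tail f)) := by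
  by_cases he : h = f
  · exact Or.inl he
  · rcases hf.2.split h with h' | h'
    · exact (hh ⟨by simp [Ne.symm he, hf.1], h'⟩).elim
    · exact Or.inr h'

/-- The edges that cut `m` off from an edge `f` are comparable. -/
theorem ReachEdge.cut_total (hf : N.ReachEdge R m f) (c₁ : ¬ N.ReachEdge (insert h₁ R) m f)
    (c₂ : ¬ N.ReachEdge (insert h₂ R) m f) : h₁ = h₂ ∨ N.EdgeReach h₁ h₂ ∨ N.EdgeReach h₂ h₁ := by
  rcases hf.of_cut c₁ with rfl | ⟨n₁, p₁, q₁⟩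
  · rcases hf.of_cut c₂ with rfl | ⟨n₂, p₂, q₂⟩
    · exact Or.inl rfl
    · exact Or.inr (Or.inr q₂.empty)
  · by_cases he₂ : h₂ = f
    · subst he₂
      exact Or.inr (Or.inl q₁.empty)
    by_cases he : h₁ = h₂
    · exact Or.inl he
    rcases p₁.split h₂ with p | ⟨-, -, p⟩
    · rcases q₁.split h₂ with q | ⟨-, q, -⟩
      · refine (c₂ ⟨by simp [Ne.symm he₂, hf.1], ?_⟩).elim
        have hsub : insert h₂ R ⊆ insert h₂ (insert h₁ R) :=
          Set.insert_subset_insert (Set.subset_insert _ _)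
        exact (p.mono hsub).trans ((q.mono hsub).cons (by simp [he, n₁]))
      · exact Or.inr (Or.inl q.empty)
    · exact Or.inr (Or.inr p.empty)

/-- What is cut off by a later cut edge of `f` is cut off by an earlier one. -/
theorem ReachEdge.cut_of_cut (hf : N.ReachEdge R m f) (c₁ : ¬ N.ReachEdge (insert h₁ R) m f)
    (c₂ : ¬ N.ReachEdge (insert h₂ R) m f) (h₁₂ : N.EdgeReach h₁ h₂)
    (cg : ¬ N.ReachEdge (insert h₂ R) m g) : ¬ N.ReachEdge (insert h₁ R) m g := by
  intro hg
  have key : N.ReachEdge (insert h₁ R) m h₂ := by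
    rcases hg.of_cut fun h => cg (h.mono (Set.insert_subset_insert (Set.subset_insert _ _)))
      with rfl | ⟨n, p, -⟩
    · exact hg
    · exact ⟨n, p.mono (Set.subset_insert _ _)⟩
  rcases hf.of_cut c₂ with rfl | ⟨-, -, q⟩
  · exact c₁ key
  · have hback : ¬ N.Reach ∅ (N.head h₂) (N.tail h₁) := fun h =>
      (Reach.trans h₁₂ (h.cons (Set.notMem_empty h₂))).not_back
    refine c₁ ⟨?_, ?_⟩
    · rintro (rfl | h)
      exacts [hback q.empty, hf.1 h]
    · exact key.2.trans (((q.mono (Set.subset_insert _ _)).avoid_left hback).cons key.1)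

/-- If every edge of `A` is cut off from `m` together with the edges of `B`, then a single edge cuts
off all of them. -/
theorem exists_common_cut [Finite E] {A B : Set E} (hA : ∃ f ∈ A, N.ReachEdge R m f)
    (hB : ∃ f ∈ B, N.ReachEdge R m f)
    (h : ∀ f ∈ A, N.ReachEdge R m f → ∃ h, ¬ N.ReachEdge (insert h R) m f ∧
      ∀ f' ∈ B, ¬ N.ReachEdge (insert h R) m f') :
    ∃ h, (∀ f ∈ A, ¬ N.ReachEdge (insert h R) m f) ∧
      ∀ f' ∈ B, ¬ N.ReachEdge (insert h R) m f' := by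
  obtain ⟨b, hb, hmb⟩ := hB
  let H : Set E := {h | (∀ f' ∈ B, ¬ N.ReachEdge (insert h R) m f') ∧
    ∃ f ∈ A, N.ReachEdge R m f ∧ ¬ N.ReachEdge (insert h R) m f}
  have hH : H.Nonempty := by
    obtain ⟨f, hf, hmf⟩ := hA
    obtain ⟨h, h₁, h₂⟩ := h f hf hmf
    exact ⟨h, h₂, f, hf, hmf, h₁⟩
  obtain ⟨e, ⟨he, -⟩, hmin⟩ := N.wellFounded_edgeReach.has_min H hH
  refine ⟨e, fun f hf => ?_, he⟩
  by_cases hmf : N.ReachEdge R m f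
  · obtain ⟨k, h₁, h₂⟩ := h f hf hmf
    rcases hmb.cut_total (he b hb) (h₂ b hb) with rfl | hek | hke
    · exact h₁
    · exact hmb.cut_of_cut (he b hb) (h₂ b hb) hek h₁
    · exact (hmin k ⟨h₂, f, hf, hmf, h₁⟩ hke).elim
  · exact fun hf' => hmf (hf'.mono (Set.subset_insert _ _))

/-- Pull `f` back to an edge `g` entering its tail. Some such `g` has no common cut edge with `f'`:
otherwise `exists_common_cut` gives one edge cutting off all of them and `f'`, hence both `f` and
`f'`. The path to `f'` obtained for `g` can be taken off `f`, since `f` does not lead to `f'`.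
Disjointness is encoded by one set: one path avoids `Q`, the other avoids its complement. -/
theorem ReachEdge.exists_disjoint_step [Finite E] (hne : f ≠ f') (hff : ¬ N.EdgeReach f f')
    (hf : N.ReachEdge R m f) (hf' : N.ReachEdge R m f')
    (hcut : ∀ h, ¬ N.ReachEdge (insert h R) m f → N.ReachEdge (insert h R) m f')
    (ih : ∀ g, N.EdgeReach g f → g ≠ f' → N.ReachEdge R m g →
      (∀ h, ¬ N.ReachEdge (insert h R) m g → N.ReachEdge (insert h R) m f') →
      ∃ Q : Set E, N.ReachEdge (Q ∪ R) m g ∧ N.ReachEdge (Qᶜ ∪ R) m f') :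
    ∃ Q : Set E, N.ReachEdge (Q ∪ R) m f ∧ N.ReachEdge (Qᶜ ∪ R) m f' := by
  by_cases hm : N.tail f = m
  · refine ⟨{f}ᶜ, ⟨by simp [hf.1], by rw [hm]; exact Reach.refl _ _ _⟩, ?_, ?_⟩
    · simp [Ne.symm hne, hf'.1]
    · rw [compl_compl, Set.singleton_union]
      exact hf'.2.avoid hff
  · have hin : ∀ R', N.Reach R' m (N.tail f) → ∃ g, N.head g = N.tail f ∧ N.ReachEdge R' m g := by
      intro R' h
      obtain ⟨g, hg, hg', hh⟩ := h.cases_snoc.resolve_left hm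
      exact ⟨g, hh, hg, hg'⟩
    obtain ⟨g, hg, hmg, hgcut⟩ : ∃ g, N.head g = N.tail f ∧ N.ReachEdge R m g ∧
        ∀ h, ¬ N.ReachEdge (insert h R) m g → N.ReachEdge (insert h R) m f' := by
      by_contra hcon
      push Not at hcon
      obtain ⟨h, h₁, h₂⟩ := exists_common_cut (A := {g | N.head g = N.tail f}) (B := {f'})
        (hin R hf.2) ⟨f', rfl, hf'⟩ fun g hg hmg => by
          obtain ⟨h, k₁, k₂⟩ := hcon g hg hmg
          exact ⟨h, k₁, by rintro _ rfl; exact k₂⟩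
      refine h₂ f' rfl (hcut h fun hfh => ?_)
      obtain ⟨g, hg, hg'⟩ := hin _ hfh.2
      exact h₁ g hg hg'
    have hgf : N.EdgeReach g f := by unfold EdgeReach; rw [hg]; exact Reach.refl _ _ _
    have hgne : g ≠ f' := by
      rintro rfl
      have : ¬ N.ReachEdge (insert g R) m g := fun h => h.1 (Set.mem_insert _ _)
      exact this (hgcut g this)
    obtain ⟨Q, hQ, hQ'⟩ := ih g hgf hgne hmg hgcut
    refine ⟨Q \ {f}, ⟨by simp [hf.1], ?_⟩, ?_, ?_⟩
    · rw [← hg]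
      exact (hQ.2.snoc hQ.1).mono (Set.union_subset_union_left _ Set.sdiff_subset)
    · have := hQ'.1
      simp only [Set.mem_union, Set.mem_compl_iff, Set.mem_sdiff, Set.mem_singleton_iff] at this ⊢
      tauto
    · refine (hQ'.2.avoid hff).mono ?_
      intro k hk
      simp only [Set.mem_union, Set.mem_compl_iff, Set.mem_sdiff, Set.mem_singleton_iff,
        Set.mem_insert_iff] at hk ⊢
      tauto

/-- Menger's theorem for two edge-disjoint paths from `m` that end with two given edges. -/
theorem ReachEdge.exists_disjoint [Finite E] (f f' : E) (hne : f ≠ f') (hf : N.ReachEdge R m f)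
    (hf' : N.ReachEdge R m f')
    (hcut : ∀ h, ¬ N.ReachEdge (insert h R) m f → N.ReachEdge (insert h R) m f') :
    ∃ Q : Set E, N.ReachEdge (Q ∪ R) m f ∧ N.ReachEdge (Qᶜ ∪ R) m f' := by
  revert hne hf hf' hcut
  refine Prod.GameAdd.recursion (C := fun f f' => f ≠ f' → N.ReachEdge R m f →
    N.ReachEdge R m f' →
    (∀ h, ¬ N.ReachEdge (insert h R) m f → N.ReachEdge (insert h R) m f') →
    ∃ Q : Set E, N.ReachEdge (Q ∪ R) m f ∧ N.ReachEdge (Qᶜ ∪ R) m f')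
    N.wellFounded_edgeReach N.wellFounded_edgeReach (fun f f' ih hne hf hf' hcut => ?_) f f'
  -- The edge pulled back must not lead to the other one; acyclicity guarantees that one of the two
  -- qualifies.
  by_cases hff : N.EdgeReach f f'
  · have hff' : ¬ N.EdgeReach f' f := fun h =>
      (Reach.trans hff (Reach.cons (Set.notMem_empty f') h)).not_back
    have symm : ∀ {f f' : E},
        (∀ h, ¬ N.ReachEdge (insert h R) m f → N.ReachEdge (insert h R) m f') →
        ∀ h, ¬ N.ReachEdge (insert h R) m f' → N.ReachEdge (insert h R) m f :=
      fun h k hk => by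
        by_contra hc
        exact hk (h k hc)
    obtain ⟨Q, hQ, hQ'⟩ := hf'.exists_disjoint_step hne.symm hff' hf (symm hcut)
      fun g hg hgf hmg hgcut => by
        obtain ⟨Q, hQ, hQ'⟩ := ih f g (Prod.GameAdd.snd hg) hgf.symm hf hmg (symm hgcut)
        exact ⟨Qᶜ, hQ', by rwa [compl_compl]⟩
    exact ⟨Qᶜ, hQ', by rwa [compl_compl]⟩
  · exact hf.exists_disjoint_step hne hff hf' hcut fun g hg hgf hmg hgcut =>
      ih g f' (Prod.GameAdd.fst hg) hgf hmg hf' hgcut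

/-- Menger's theorem for two edge-disjoint paths from `m` to two given nodes. -/
theorem Reach.exists_disjoint [Finite E] (ha : N.Reach R m a) (hb : N.Reach R m b) (hma : a ≠ m)
    (hmb : b ≠ m) (hcut : ∀ h, ¬ N.Reach (insert h R) m a → N.Reach (insert h R) m b) :
    ∃ Q : Set E, N.Reach (Q ∪ R) m a ∧ N.Reach (Qᶜ ∪ R) m b := by
  have hin : ∀ R' c, c ≠ m → N.Reach R' m c → ∃ g ∈ {g | N.head g = c}, N.ReachEdge R' m g := by
    intro R' c hc h
    obtain ⟨g, hg, hg', hh⟩ := h.cases_snoc.resolve_left hc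
    exact ⟨g, hh, hg, hg'⟩
  obtain ⟨f, hf, hmf, hfcut⟩ : ∃ f, N.head f = a ∧ N.ReachEdge R m f ∧
      ∀ h, ¬ N.ReachEdge (insert h R) m f →
        ∃ f' ∈ {g | N.head g = b}, N.ReachEdge (insert h R) m f' := by
    by_contra hcon
    push Not at hcon
    obtain ⟨h, h₁, h₂⟩ := exists_common_cut (hin R a hma ha) (hin R b hmb hb) hcon
    obtain ⟨g, hg, hg'⟩ := hin _ b hmb (hcut h fun h' => by
      obtain ⟨g, hg, hg'⟩ := hin _ a hma h'
      exact h₁ g hg hg')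
    exact h₂ g hg hg'
  obtain ⟨f', hf', hmf', hfcut'⟩ : ∃ f', N.head f' = b ∧ N.ReachEdge R m f' ∧
      ∀ h, ¬ N.ReachEdge (insert h R) m f' → N.ReachEdge (insert h R) m f := by
    by_contra hcon
    push Not at hcon
    obtain ⟨h, h₁, h₂⟩ := exists_common_cut (B := {f}) (hin R b hmb hb) ⟨f, rfl, hmf⟩
      fun g hg hmg => by
        obtain ⟨h, k₁, k₂⟩ := hcon g hg hmg
        exact ⟨h, k₁, by rintro _ rfl; exact k₂⟩
    obtain ⟨g, hg, hg'⟩ := hfcut h (h₂ f rfl)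
    exact h₁ g hg hg'
  have hne : f ≠ f' := by
    rintro rfl
    have : ¬ N.ReachEdge (insert f R) m f := fun h => h.1 (Set.mem_insert _ _)
    exact this (hfcut' f this)
  obtain ⟨Q, hQ, hQ'⟩ := ReachEdge.exists_disjoint f f' hne hmf hmf' fun h hh => by
    by_contra hc
    exact hh (hfcut' h hc)
  exact ⟨Q, hf ▸ hQ.2.snoc hQ.1, hf' ▸ hQ'.2.snoc hQ'.1⟩

end Menger

/-! ### The bottleneck edge and decoding behind it. -/

section Late

variable {V E : Type*} {N : SumNetwork V E (Fin 3) (Fin 3)} {e : E} {a b : V}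

/-- There is a path from the source `i` to the node `a`. -/
def FromSource (N : SumNetwork V E (Fin 3) (Fin 3)) (i : Fin 3) (a : V) : Prop :=
  N.Reach ∅ (N.source i) a

/-- There is a path through the edge `e` to the node `a`. -/
def After (N : SumNetwork V E (Fin 3) (Fin 3)) (e : E) (a : V) : Prop :=
  N.Reach ∅ (N.head e) a

/-- The edge `e` carries symbols only from the sources `1` and `2` and only towards the terminals
`1` and `2`, and it disconnects the pairs `(1, 1)`, `(1, 2)` and `(2, 1)`, but not `(2, 2)`. -/
structure Bottleneck (N : SumNetwork V E (Fin 3) (Fin 3)) (e : E) : Prop where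
  conn : N.Connected
  source_zero : ¬ N.FromSource 0 (N.tail e)
  source_one : N.FromSource 1 (N.tail e)
  source_two : N.FromSource 2 (N.tail e)
  terminal_zero : ¬ N.After e (N.terminal 0)
  terminal_one : N.After e (N.terminal 1)
  terminal_two : N.After e (N.terminal 2)
  cut_one_one : ¬ N.Reach {e} (N.source 1) (N.terminal 1)
  cut_one_two : ¬ N.Reach {e} (N.source 1) (N.terminal 2)
  cut_two_one : ¬ N.Reach {e} (N.source 2) (N.terminal 1)
  reach_two_two : N.Reach {e} (N.source 2) (N.terminal 2)

theorem After.trans (ha : N.After e a) {R : Set E} (h : N.Reach R a b) : N.After e b :=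
  Reach.trans ha h.empty

theorem After.ne_of_head {f : E} (h : ¬ N.After e (N.head f)) : f ≠ e := by
  rintro rfl
  exact h (Reach.refl _ _ _)

theorem not_after_tail : ¬ N.After e (N.tail e) := fun h => h.not_back

theorem Reach.avoid_of_not_after (h : N.Reach ∅ a b) (hb : ¬ N.After e b) : N.Reach {e} a b := by
  have := h.avoid hb
  simpa using this

theorem Reach.avoid_of_after (h : N.Reach ∅ a b) (ha : N.After e a) : N.Reach {e} a b := by
  have := h.avoid_left (f := e) fun h => (ha.trans h).not_back
  simpa using this

namespace Bottleneck

variable (B : N.Bottleneck e)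
include B

theorem reach_zero (j : Fin 3) : N.Reach {e} (N.source 0) (N.terminal j) := by
  have := (B.conn 0 j).avoid_left (f := e) B.source_zero
  simpa using this

theorem not_after_source (i : Fin 3) : ¬ N.After e (N.source i) :=
  fun h => B.terminal_zero (h.trans (B.conn i 0))

variable [Fintype E]

/-- It suffices to code for the edges before `e`: the last two terminals decode behind `e`. -/
theorem xorSolvable_of_code_before [DecidableEq V] (g : E → Fin 3 → ℤ)
    (hg : ∀ f, ¬ N.After e (N.tail f) → N.Derivable g (N.tail f) (g f))
    (ht : N.Derivable g (N.terminal 0) 1)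
    (he : g e = Pi.single 1 1 + Pi.single 2 1)
    (hpure : ∀ f, ¬ N.After e (N.tail f) → N.FromSource 0 (N.tail f) →
      ¬ N.FromSource 1 (N.tail f) → ¬ N.FromSource 2 (N.tail f) → g f = Pi.single 0 1)
    (hterm : ∃ c : E → ℤ, (∀ f, IsSign (c f)) ∧ (∀ f, c f ≠ 0 → f ≠ e ∧ ¬ N.After e (N.tail f) ∧
      N.After e (N.head f) ∧ N.Reach ∅ (N.head f) (N.terminal 2) ∧
      (N.FromSource 0 (N.tail f) ∨ N.FromSource 2 (N.tail f))) ∧ ∑ f, c f • g f = Pi.single 0 1) :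
    N.XORSolvableOverAllFields := by
  classical
  let D : V → Prop := N.After e
  let Z : Set E := {f | D (N.tail f)}
  have hZ : ∀ {a b}, N.Reach ∅ a b → D a → N.Reach Zᶜ a b := by
    intro a b h ha
    refine h.restrict fun f _ hf _ => ?_
    exact not_not.2 (After.trans ha hf)
  -- Apart from `e`, no edge entering the region behind `e` and leading to terminal 1 is fed by
  -- source 1 or 2, because `e` separates both from terminal 1.
  have hnot : ∀ f, ¬ D (N.tail f) → f ≠ e → N.Reach ∅ (N.head f) (N.terminal 1) →
      D (N.head f) → ¬ N.FromSource 1 (N.tail f) ∧ ¬ N.FromSource 2 (N.tail f) := by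
    intro f hf hfe hr hD
    have h₁ : N.Reach {e} (N.tail f) (N.terminal 1) :=
      (hr.avoid_of_after hD).cons (by simpa using hfe)
    exact ⟨fun h => B.cut_one_one ((Reach.avoid_of_not_after h hf).trans h₁),
      fun h => B.cut_two_one ((Reach.avoid_of_not_after h hf).trans h₁)⟩
  obtain ⟨c, hc₁, hc₂, hc₃⟩ := hterm
  obtain ⟨f₀, d, hf₀e, hf₀D, hf₀D', hf₀S, hf₀t, hd₁, hd₂, hd₃, hd₄⟩ : ∃ (f₀ : E) (d : E → ℤ),
      f₀ ≠ e ∧ ¬ D (N.tail f₀) ∧ D (N.head f₀) ∧ N.FromSource 0 (N.tail f₀) ∧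
      N.Reach ∅ (N.head f₀) (N.terminal 1) ∧ (∀ f, IsSign (d f)) ∧
      (∀ f, d f ≠ 0 → f ≠ e ∧ ¬ D (N.tail f) ∧ D (N.head f) ∧
        N.Reach ∅ (N.head f) (N.terminal 2)) ∧ ∑ f, d f • g f = Pi.single 0 1 ∧
      ∀ f, N.Reach ∅ (N.head f) (N.terminal 1) → N.Reach ∅ (N.head f) (N.terminal 2) →
        d f = if f = f₀ then 1 else 0 := by
    -- The routings to terminals 1 and 2 must agree on inputs that lead to both. If an edge with x₀
    -- leads to both, it serves both. If not, the two sources of x₀ share no such input, and the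
    -- given combination `c` can be kept for terminal 2.
    by_cases hex : ∃ f₀, f₀ ≠ e ∧ ¬ D (N.tail f₀) ∧ D (N.head f₀) ∧ N.FromSource 0 (N.tail f₀) ∧
      N.Reach ∅ (N.head f₀) (N.terminal 1) ∧ N.Reach ∅ (N.head f₀) (N.terminal 2)
    · obtain ⟨f₀, h₁, h₂, h₃, h₄, h₅, h₆⟩ := hex
      refine ⟨f₀, fun f => if f = f₀ then 1 else 0, h₁, h₂, h₃, h₄, h₅, fun f => ?_, fun f hf => ?_,
        ?_, fun f _ _ => rfl⟩
      · dsimp only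
        split_ifs
        exacts [IsSign.one, IsSign.zero]
      · obtain rfl : f = f₀ := by
          by_contra h
          simp [h] at hf
        exact ⟨h₁, h₂, h₃, h₆⟩
      · obtain ⟨k₁, k₂⟩ := hnot f₀ h₂ h₁ h₅ h₃
        simpa using hpure f₀ h₂ h₄ k₁ k₂
    · obtain ⟨f₀, h₁, h₂, h₃, h₄, h₅⟩ :=
        (B.reach_zero 1).entry (D := D) (B.not_after_source 0) B.terminal_one
      refine ⟨f₀, c, h₁, h₂, h₃, h₄.empty, h₅.empty, hc₁, fun f hf => ?_, hc₃, fun f hf hf' => ?_⟩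
      · obtain ⟨k₁, k₂, k₃, k₄, -⟩ := hc₂ f hf
        exact ⟨k₁, k₂, k₃, k₄⟩
      · by_cases hcf : c f = 0
        · rw [hcf, if_neg]
          rintro rfl
          exact hex ⟨f, h₁, h₂, h₃, h₄.empty, hf, hf'⟩
        · obtain ⟨k₁, k₂, k₃, k₄, k₅ | k₅⟩ := hc₂ f hcf
          · exact (hex ⟨f, k₁, k₂, k₃, k₅, hf, k₄⟩).elim
          · exact ((hnot f k₂ k₁ hf k₃).2 k₅).elim
  have hg₀ : g f₀ = Pi.single 0 1 := by
    obtain ⟨k₁, k₂⟩ := hnot f₀ hf₀D hf₀e hf₀t hf₀D'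
    exact hpure f₀ hf₀D hf₀S k₁ k₂
  let cp : Fin 3 ⊕ E → ℤ := Sum.elim (fun _ => 0) fun f =>
    if f = e then 1 else if f = f₀ then 1 else 0
  let cq : Fin 3 ⊕ E → ℤ := Sum.elim (fun _ => 0) fun f => if f = e then 1 else d f
  have hde : d e = 0 := by
    by_contra h
    exact (hd₂ e h).1 rfl
  have sum_ite : ∀ d : E → ℤ, d e = 0 → ∑ f, d f • g f = Pi.single 0 1 →
      ∑ k, (Sum.elim (fun _ => 0) fun f => if f = e then 1 else d f : Fin 3 ⊕ E → ℤ) k •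
        inputVec g k = 1 := by
    intro d hd hsum
    have : ∀ f, (if f = e then 1 else d f) • g f = (if f = e then g f else 0) + d f • g f := by
      intro f
      by_cases h : f = e
      · subst h; simp [hd]
      · simp [h]
    rw [Fintype.sum_sum_type]
    simp only [Sum.elim_inl, zero_smul, Finset.sum_const_zero, zero_add, Sum.elim_inr, inputVec,
      this, Finset.sum_add_distrib, hsum, Finset.sum_ite_eq', Finset.mem_univ, if_true, he]
    rw [← sum_single_one, Fin.sum_univ_three]
    abel
  have cpne : ∀ f, cp (Sum.inr f) ≠ 0 → f = e ∨ f = f₀ := by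
    intro f hf
    by_contra h
    push Not at h
    simp [cp, h.1, h.2] at hf
  have cqne : ∀ f, cq (Sum.inr f) ≠ 0 → f = e ∨ d f ≠ 0 := by
    intro f hf
    by_contra h
    push Not at h
    simp [cq, h.1, h.2] at hf
  obtain ⟨tv, -, -, htv⟩ := N.exists_forest_code Z (N.terminal 1) (N.terminal 2) cp cq (by
      rintro (i | f)
      · exact IsSign.zero
      · simp only [cp, Sum.elim_inr]
        split_ifs
        exacts [IsSign.one, IsSign.one, IsSign.zero]) (by
      rintro (i | f)
      · exact IsSign.zero
      · simp only [cq, Sum.elim_inr]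
        split_ifs
        exacts [IsSign.one, hd₁ f]) (by
      intro f hf
      by_contra h
      rcases cpne f h with rfl | rfl
      exacts [not_after_tail hf, hf₀D hf]) (by
      intro f hf
      by_contra h
      rcases cqne f h with rfl | h
      exacts [not_after_tail hf, (hd₂ f h).2.1 hf]) (by
      rintro (i | f) hk
      · exact (hk rfl).elim
      · rcases cpne f hk with rfl | rfl
        exacts [hZ B.terminal_one (Reach.refl _ _ _), hZ hf₀t hf₀D']) (by
      rintro (i | f) hk
      · exact (hk rfl).elim
      · rcases cqne f hk with rfl | h
        exacts [hZ B.terminal_two (Reach.refl _ _ _), hZ (hd₂ f h).2.2.2 (hd₂ f h).2.2.1]) (by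
      rintro (i | f) h₁ h₂
      · rfl
      · simp only [cp, cq, Sum.elim_inr]
        rw [hd₄ f h₁.empty h₂.empty]) g
  let G : E → Fin 3 → ℤ := fun f => if f ∈ Z then tv f else g f
  obtain ⟨hG₁, hG₂, hG₃⟩ := htv G (fun f hf => if_neg hf) (fun f hf _ => if_pos hf)
  have hcongr : ∀ a y, ¬ D a → N.Derivable g a y → N.Derivable G a y := by
    rintro a y ha ⟨c, h₁, h₂, rfl⟩
    refine ⟨c, h₁, h₂, Finset.sum_congr rfl ?_⟩
    rintro (i | f) -
    · rfl
    · by_cases hcf : c (Sum.inr f) = 0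
      · simp [hcf]
      · have hfa : N.head f = a := h₂ _ hcf
        have : f ∉ Z := fun h => ha (hfa ▸ After.trans h (Reach.edge (Set.notMem_empty f)))
        simp [inputVec, G, this]
  refine xorSolvable_of_derivable G (fun f => ?_) fun j => ?_
  · by_cases hf : f ∈ Z
    · rw [show G f = tv f from if_pos hf]
      exact hG₁ f
    · rw [show G f = g f from if_neg hf]
      exact hcongr _ _ hf (hg f hf)
  · fin_cases j
    · exact hcongr _ _ B.terminal_zero ht
    · have := sum_ite (fun f => if f = f₀ then 1 else 0) (if_neg hf₀e.symm) (by simpa using hg₀)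
      rw [← this]
      exact hG₂
    · rw [← sum_ite d hde hd₃]
      exact hG₃

end Bottleneck

end Late

/-! ### Splittings: separating x₀ from x₂ on the edges leading to terminal 2. -/

section Split

variable {V E : Type*} {N : SumNetwork V E (Fin 3) (Fin 3)} {e : E}

/-- A choice of a node `m`, edges `X` through which `m` receives the symbol of source `2`, and edges
`Q` that are to carry the symbol of source `0`, such that the symbol of source `2` is available
from `m` at terminal `0` without use of `Q`, and the symbol of source `0` can be decoded at
terminal `2`. -/
structure Splitting (N : SumNetwork V E (Fin 3) (Fin 3)) (e : E) (m : V) (X Q : Set E) : Prop where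
  from_two : N.FromSource 2 m
  to_two : N.Reach {e} m (N.terminal 2)
  through : ∀ a, ¬ N.After e a → N.FromSource 2 a →
    (N.Reach (X ∪ {e}) a (N.terminal 0) ∨ N.Reach (X ∪ {e}) a (N.terminal 2)) → N.Reach ∅ m a
  into : ∀ f ∈ X, N.head f = m ∧ N.FromSource 2 (N.tail f)
  start : m = N.source 2 ∨ X.Nonempty
  zero_two : N.Reach (X ∪ {e}) (N.source 0) (N.terminal 2)
  zero_zero : N.Reach (X ∪ {e}) (N.source 0) (N.terminal 0)
  carry : ∀ f ∈ Q, f ∉ X ∧ N.Reach (X ∪ {e}) (N.source 0) (N.tail f) ∧ (N.tail f = N.source 0 ∨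
    (∃ f' ∈ Q, N.head f' = N.tail f) ∨ N.tail f = m ∨ ∃ f', f' ∉ Q ∧ N.head f' = N.tail f ∧
      ¬ N.Reach (X ∪ {e}) (N.source 0) (N.tail f') ∧ N.Reach Q m (N.tail f'))
  two_zero : N.Reach Q m (N.terminal 0)
  decode : (∃ f ∈ Q, f ≠ e ∧ ¬ N.After e (N.tail f) ∧ N.After e (N.head f) ∧
      N.Reach ∅ (N.head f) (N.terminal 2)) ∨
    ((∃ f, f ∉ Q ∧ f ≠ e ∧ ¬ N.After e (N.tail f) ∧ N.After e (N.head f) ∧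
      N.Reach ∅ (N.head f) (N.terminal 2) ∧ ¬ N.Reach (X ∪ {e}) (N.source 0) (N.tail f) ∧
      N.Reach Q m (N.tail f)) ∧
    ∃ f, f ≠ e ∧ ¬ N.After e (N.tail f) ∧ N.After e (N.head f) ∧
      N.Reach ∅ (N.head f) (N.terminal 2) ∧ N.Reach (X ∪ {e}) (N.source 0) (N.tail f))

open Classical in
/-- The symbols of the edges that reach terminal `2` without passing through `e`. -/
noncomputable def splitVec (N : SumNetwork V E (Fin 3) (Fin 3)) (e : E) (m : V) (X Q : Set E)
    (f : E) : Fin 3 → ℤ :=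
  if N.FromSource 2 (N.tail f) ∧ ¬ N.Reach ∅ m (N.tail f) then Pi.single 2 1 else
    if f ∈ Q then Pi.single 0 1 else
      supportSum (N.Reach (X ∪ {e}) (N.source 0) (N.tail f)) (N.Reach Q m (N.tail f))
        (Pi.single 0 1) (Pi.single 2 1)

namespace Splitting

variable {m : V} {X Q : Set E} (K : N.Splitting e m X Q) (B : N.Bottleneck e) {a : V}
  {g : E → Fin 3 → ℤ}

include K in
theorem not_reach_tail {f : E} (hf : f ∈ X) : ¬ N.Reach ∅ m (N.tail f) := fun h => by
  rw [← (K.into f hf).1] at h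
  exact h.not_back

include K in
theorem avoid {R : Set E} {b : V} (ha : N.Reach ∅ m a) (h : N.Reach R a b) :
    N.Reach (X ∪ R) a b := by
  refine h.restrict fun f hf hf' _ => ?_
  rintro (hfX | hfR)
  exacts [K.not_reach_tail hfX (ha.trans hf'.empty), hf hfR]

-- Otherwise the tail of `f` has a path through its head to terminal 2 off `X` and `e`, and
-- `through` puts that tail behind `m`.
include K in
theorem mem_of_head {f : E} (hC : N.Reach {e} (N.head f) (N.terminal 2))
    (hD : ¬ N.After e (N.head f)) (hm : N.Reach ∅ m (N.head f)) (h₂ : N.FromSource 2 (N.tail f))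
    (hf : ¬ N.Reach ∅ m (N.tail f)) : f ∈ X := by
  by_contra hX
  refine hf (K.through _ (fun h => hD (h.trans (Reach.edge (Set.notMem_empty f)))) h₂ (Or.inr ?_))
  exact (K.avoid hm hC).cons (by simp [hX, After.ne_of_head hD])

section Node

variable (hC : N.Reach {e} a (N.terminal 2)) (hD : ¬ N.After e a)
  (ha : N.Reach ∅ m a ∨ ¬ N.FromSource 2 a)
  (hg : ∀ f, N.head f = a → g f = N.splitVec e m X Q f)

include K hC hD ha in
theorem not_before {f : E} (hf : N.head f = a) (hX : f ∉ X) :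
    ¬ (N.FromSource 2 (N.tail f) ∧ ¬ N.Reach ∅ m (N.tail f)) := by
  subst hf
  rintro ⟨h₁, h₂⟩
  rcases ha with ha | ha
  · exact hX (K.mem_of_head hC hD ha h₁ h₂)
  · exact ha (Reach.snoc h₁ (Set.notMem_empty f))

include K hC hD ha hg

/-- The last edge of the path carries x₀ alone if it is in `Q`. Otherwise x₂ is mixed in only when
it comes from `m` off `Q`, and then it is present at `a` as well. -/
theorem exists_input_zero (h : N.Reach (X ∪ {e}) (N.source 0) a) :
    ∃ k, N.inputNode k = a ∧ (inputVec g k = Pi.single 0 1 ∨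
      N.Reach Q m a ∧ inputVec g k = Pi.single 0 1 + Pi.single 2 1) := by
  rcases h.cases_snoc with rfl | ⟨f, hf, hf', rfl⟩
  · exact ⟨Sum.inl 0, rfl, Or.inl rfl⟩
  · have hX : f ∉ X := fun h => hf (Or.inl h)
    have hz := K.not_before hC hD ha rfl hX
    refine ⟨Sum.inr f, rfl, ?_⟩
    simp only [inputVec, Sum.elim_inr, hg f rfl, splitVec, if_neg hz]
    by_cases hQ : f ∈ Q
    · exact Or.inl (if_pos hQ)
    · rw [if_neg hQ]
      by_cases hP : N.Reach Q m (N.tail f)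
      · exact Or.inr ⟨hP.snoc hQ, by simp [-Set.union_singleton, supportSum, hP, hf']⟩
      · exact Or.inl (by simp [-Set.union_singleton, supportSum, hP, hf'])

/-- At `m` itself `start` supplies x₂ alone; beyond `m` the last edge of the path is off `Q`, so x₂
has not been removed from it. -/
theorem exists_input_two (h : N.Reach Q m a) :
    ∃ k, N.inputNode k = a ∧ (inputVec g k = Pi.single 2 1 ∨
      N.Reach (X ∪ {e}) (N.source 0) a ∧ inputVec g k = Pi.single 0 1 + Pi.single 2 1) := by
  rcases h.cases_snoc with rfl | ⟨f, hf, hf', rfl⟩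
  · rcases K.start with h | ⟨f, hf⟩
    · exact ⟨Sum.inl 2, h.symm, Or.inl rfl⟩
    · obtain ⟨h₁, h₂⟩ := K.into f hf
      refine ⟨Sum.inr f, h₁, Or.inl ?_⟩
      simp only [inputVec, Sum.elim_inr, hg f h₁, splitVec]
      rw [if_pos ⟨h₂, K.not_reach_tail hf⟩]
  · refine ⟨Sum.inr f, rfl, ?_⟩
    simp only [inputVec, Sum.elim_inr, hg f rfl, splitVec]
    rw [if_neg fun h => h.2 hf'.empty, if_neg hf]
    by_cases hZ : N.Reach (X ∪ {e}) (N.source 0) (N.tail f)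
    · refine Or.inr ⟨hZ.snoc ?_, by simp [-Set.union_singleton, supportSum, hZ, hf']⟩
      rintro (hX | hX)
      · exact K.not_reach_tail hX hf'.empty
      · exact After.ne_of_head hD hX
    · exact Or.inl (by simp [-Set.union_singleton, supportSum, hZ, hf'])

theorem derivable_node [Fintype E] : N.Derivable g a
    (supportSum (N.Reach (X ∪ {e}) (N.source 0) a) (N.Reach Q m a)
      (Pi.single 0 1) (Pi.single 2 1)) :=
  derivable_supportSum (single_one_ne (by decide)) (K.exists_input_zero hC hD ha hg) fun h => by
    exact K.exists_input_two hC hD ha hg h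

end Node

-- Before `m`, x₂ is forwarded; off `Q`, the tail adds up what is present. On `Q`, x₂ must be
-- stripped off, and `carry` lists the ways: x₀ arrives alone, or x₂ arrives alone and can be
-- subtracted.
include K in
theorem derivable_edge [Fintype E] {f : E} (hC : N.Reach {e} (N.tail f) (N.terminal 2))
    (hD : ¬ N.After e (N.tail f)) (hg : ∀ f', N.head f' = N.tail f → g f' = N.splitVec e m X Q f') :
    N.Derivable g (N.tail f) (N.splitVec e m X Q f) := by
  by_cases hz : N.FromSource 2 (N.tail f) ∧ ¬ N.Reach ∅ m (N.tail f)
  · rw [splitVec, if_pos hz]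
    rcases Reach.cases_snoc hz.1 with h | ⟨f', -, hf', hh⟩
    · exact derivable_source 2 h.symm
    · have hm : ¬ N.Reach ∅ m (N.tail f') := fun h =>
        hz.2 (hh ▸ h.snoc (Set.notMem_empty f'))
      refine SumNetwork.derivable_edge f' hh ?_
      rw [hg f' hh, splitVec, if_pos ⟨hf', hm⟩]
  · have ha : N.Reach ∅ m (N.tail f) ∨ ¬ N.FromSource 2 (N.tail f) := by tauto
    rw [splitVec, if_neg hz]
    by_cases hQ : f ∈ Q
    · rw [if_pos hQ]
      obtain ⟨-, hZ, h⟩ := K.carry f hQ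
      have sub : (∃ k, N.inputNode k = N.tail f ∧ inputVec g k = Pi.single 2 1) →
          N.Derivable g (N.tail f) (Pi.single 0 1) := by
        rintro ⟨l, hl, hl'⟩
        obtain ⟨k, hk, hk' | ⟨-, hk'⟩⟩ := K.exists_input_zero hC hD ha hg hZ
        · exact hk' ▸ derivable_input k hk
        · have hne : k ≠ l := by
            rintro rfl
            rw [hl'] at hk'
            have := congrFun hk' 0
            simp at this
          have := derivable_sub_inputs (g := g) hne hk hl
          rwa [hk', hl', add_sub_cancel_right] at this
      rcases h with h | ⟨f', hf', hh⟩ | h | ⟨f', hf', hh, hZ', hP⟩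
      · exact derivable_source 0 h.symm
      · refine SumNetwork.derivable_edge f' hh ?_
        rw [hg f' hh, splitVec, if_neg (K.not_before hC hD ha hh (K.carry f' hf').1), if_pos hf']
      · rcases K.start with h' | ⟨f', hf'⟩
        · exact sub ⟨Sum.inl 2, (h.trans h').symm, rfl⟩
        · obtain ⟨h₁, h₂⟩ := K.into f' hf'
          refine sub ⟨Sum.inr f', h₁.trans h.symm, ?_⟩
          simp only [inputVec, Sum.elim_inr, hg f' (h₁.trans h.symm), splitVec]
          rw [if_pos ⟨h₂, K.not_reach_tail hf'⟩]
      · refine sub ⟨Sum.inr f', hh, ?_⟩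
        simp only [inputVec, Sum.elim_inr, hg f' hh, splitVec]
        rw [if_neg fun h => h.2 hP.empty, if_neg hf']
        simp [-Set.union_singleton, supportSum, hZ', hP]
    · rw [if_neg hQ]
      exact K.derivable_node hC hD ha hg

-- Source 0 does not reach `e`, so neither x₀ nor `Q` occurs upstream of `e`; source 1 cannot feed
-- an edge that leads to terminal 2 off `e`. Hence both sides are x₂ or 0, and the code for terminal
-- 2 can share edges with the code that feeds `e`.
include K B in
theorem splitVec_of_reach_tail {f : E} (hC : N.Reach {e} (N.tail f) (N.terminal 2))
    (hD : ¬ N.After e (N.tail f)) (hu : N.Reach ∅ (N.tail f) (N.tail e)) :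
    N.splitVec e m X Q f = supportSum (N.FromSource 1 (N.tail f)) (N.FromSource 2 (N.tail f))
      (Pi.single 1 1) (Pi.single 2 1) := by
  have h₀ : ∀ {R : Set E} {b}, N.Reach ∅ b (N.tail f) → ¬ N.Reach R (N.source 0) b :=
    fun hb h => B.source_zero (h.empty.trans (hb.trans hu))
  have h₁ : ¬ N.FromSource 1 (N.tail f) := fun h =>
    B.cut_one_two ((Reach.avoid_of_not_after h hD).trans hC)
  have hQ : ∀ f' ∈ Q, ¬ N.Reach ∅ (N.tail f') (N.tail f) := fun f' hf' h =>
    h₀ h (K.carry f' hf').2.1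
  by_cases h₂ : N.FromSource 2 (N.tail f)
  · by_cases hm : N.Reach ∅ m (N.tail f)
    · have hP : N.Reach Q m (N.tail f) := hm.restrict fun f' _ _ hf' hQ' =>
        hQ f' hQ' (hf'.cons (Set.notMem_empty f'))
      rw [splitVec, if_neg fun h => h.2 hm, if_neg fun h => hQ f h (Reach.refl _ _ _)]
      simp [-Set.union_singleton, supportSum, h₁, h₂, hP, h₀ (Reach.refl N ∅ (N.tail f))]
    · rw [splitVec, if_pos ⟨h₂, hm⟩]
      simp [-Set.union_singleton, supportSum, h₁, h₂]
  · have hP : ¬ N.Reach Q m (N.tail f) := fun h => h₂ (Reach.trans K.from_two h.empty)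
    rw [splitVec, if_neg fun h => h₂ h.1, if_neg fun h => hQ f h (Reach.refl _ _ _)]
    simp [-Set.union_singleton, supportSum, h₁, h₂, hP, h₀ (Reach.refl N ∅ (N.tail f))]

-- Edges of `X` are fed by source 2 and `e` does not lead here, so the path from source 0 avoids
-- both.
include K in
theorem splitVec_of_only_zero {f : E} (hD : ¬ N.After e (N.tail f))
    (h₀ : N.FromSource 0 (N.tail f)) (h₂ : ¬ N.FromSource 2 (N.tail f)) :
    N.splitVec e m X Q f = Pi.single 0 1 := by
  have hP : ¬ N.Reach Q m (N.tail f) := fun h => h₂ (Reach.trans K.from_two h.empty)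
  have hZ : N.Reach (X ∪ {e}) (N.source 0) (N.tail f) := by
    refine Reach.restrict h₀ fun f' _ _ hf' => ?_
    rintro (hX | rfl)
    · exact h₂ (Reach.trans (K.into f' hX).2 (hf'.cons (Set.notMem_empty f')))
    · exact hD hf'
  rw [splitVec, if_neg fun h => h₂ h.1]
  simp [-Set.union_singleton, supportSum, hP, hZ]

open Classical in
include K B in
/-- The symbols of the sources `0` and `2` are available, alone or as a sum, at nodes from which
terminal `0` is reached by edges that do not lead to terminal `2`. -/
theorem exists_roots [Fintype E] (hg : ∀ f, f ≠ e → N.Reach {e} (N.head f) (N.terminal 2) →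
      ¬ N.After e (N.tail f) → g f = N.splitVec e m X Q f) :
    ∃ c : Fin 3 ⊕ E → ℤ, (∀ k, IsSign (c k)) ∧
      (∀ k, c k ≠ 0 → N.Reach {e} (N.inputNode k) (N.terminal 2) ∧
        N.Reach {f | N.Reach {e} (N.head f) (N.terminal 2)} (N.inputNode k) (N.terminal 0)) ∧
      ∑ k, c k • inputVec g k = Pi.single 0 1 + Pi.single 2 1 ∧
      ∀ A : Set V, (∑ k, if N.inputNode k ∈ A then c k • inputVec g k else 0) = 0 ∨
        ((∑ k, if N.inputNode k ∈ A then c k • inputVec g k else 0) = Pi.single 2 1 ∧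
          ∃ a ∈ A, N.FromSource 2 a) ∨
        ((∑ k, if N.inputNode k ∈ A then c k • inputVec g k else 0) = Pi.single 0 1 ∧
          ∃ a ∈ A, N.FromSource 0 a) ∨
        ((∃ a ∈ A, N.FromSource 0 a) ∧ ∃ a ∈ A, N.FromSource 2 a) := by
  have hCt : ¬ N.Reach {e} (N.terminal 0) (N.terminal 2) := fun h =>
    B.cut_one_two (((B.conn 1 0).avoid_of_not_after B.terminal_zero).trans h)
  -- The last nodes from which terminal 2 is still reachable off `e`, on the way to terminal 0: `w`
  -- on a path of x₂ from `m` off `Q`, and `w'` on a path of x₀.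
  obtain ⟨w, hCw, hPw, hwt⟩ := K.two_zero.last_exit
    (C := fun a => N.Reach {e} a (N.terminal 2)) K.to_two hCt
  obtain ⟨w', hCw', hZw', hwt'⟩ := K.zero_zero.last_exit
    (C := fun a => N.Reach {e} a (N.terminal 2)) (B.reach_zero 2) hCt
  have hDw : ¬ N.After e w := fun h => B.terminal_zero (h.trans hwt)
  have hDw' : ¬ N.After e w' := fun h => B.terminal_zero (h.trans hwt')
  have hgw : ∀ b, N.Reach {e} b (N.terminal 2) → ¬ N.After e b → ∀ f, N.head f = b →
      g f = N.splitVec e m X Q f := by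
    rintro b hC hD f rfl
    exact hg f (After.ne_of_head hD) hC
      fun h => hD (h.trans (Reach.edge (Set.notMem_empty f)))
  have hw := K.derivable_node hCw hDw (Or.inl hPw.empty) (hgw w hCw hDw)
  have hw' := K.derivable_node hCw' hDw' (by
    by_cases h : N.FromSource 2 w'
    · exact Or.inl (K.through w' hDw' h (Or.inl (hwt'.mono Set.subset_union_left)))
    · exact Or.inr h) (hgw w' hCw' hDw')
  have hS₂ : ∀ {b}, N.Reach Q m b → N.FromSource 2 b := fun h => Reach.trans K.from_two h.empty
  have hS₀ : ∀ {b}, N.Reach (X ∪ {e}) (N.source 0) b → N.FromSource 0 b := fun h => h.empty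
  have part : ∀ (c : Fin 3 ⊕ E → ℤ) (b : V) (A : Set V), (∀ k, c k ≠ 0 → N.inputNode k = b) →
      (∑ k, if N.inputNode k ∈ A then c k • inputVec g k else 0) =
        if b ∈ A then ∑ k, c k • inputVec g k else 0 := by
    intro c b A hc
    by_cases hb : b ∈ A
    · rw [if_pos hb]
      refine Finset.sum_congr rfl fun k _ => ?_
      by_cases hk : c k = 0
      · simp [hk]
      · rw [if_pos (by rw [hc k hk]; exact hb)]
    · rw [if_neg hb]
      refine Finset.sum_eq_zero fun k _ => ?_
      by_cases hk : c k = 0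
      · simp [hk]
      · rw [if_neg (by rw [hc k hk]; exact hb)]
  -- Either one node offers x₀ + x₂ and is the only root, or `w` offers just x₂ and `w'` just x₀,
  -- which makes them distinct roots.
  by_cases hex : ∃ b, N.Reach {e} b (N.terminal 2) ∧
      N.Reach {f | N.Reach {e} (N.head f) (N.terminal 2)} b (N.terminal 0) ∧
      N.FromSource 0 b ∧ N.FromSource 2 b ∧ N.Derivable g b (Pi.single 0 1 + Pi.single 2 1)
  · obtain ⟨b, hC, ht, h₀, h₂, c, hc₁, hc₂, hc₃⟩ := hex
    refine ⟨c, hc₁, fun k hk => ?_, hc₃.symm, fun A => ?_⟩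
    · rw [hc₂ k hk]
      exact ⟨hC, ht⟩
    · rw [part c b A hc₂]
      by_cases hb : b ∈ A
      · exact Or.inr (Or.inr (Or.inr ⟨⟨b, hb, h₀⟩, b, hb, h₂⟩))
      · exact Or.inl (if_neg hb)
  have hZw : ¬ N.Reach (X ∪ {e}) (N.source 0) w := fun hZw =>
    hex ⟨w, hCw, hwt.mono Set.subset_union_right, hS₀ hZw, hS₂ hPw, by
      simpa [-Set.union_singleton, supportSum, hZw, hPw] using hw⟩
  have hPw' : ¬ N.Reach Q m w' := fun hPw' =>
    hex ⟨w', hCw', hwt'.mono Set.subset_union_right, hS₀ hZw', hS₂ hPw', by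
      simpa [-Set.union_singleton, supportSum, hZw', hPw'] using hw'⟩
  obtain ⟨c, hc₁, hc₂, hc₃⟩ := hw
  obtain ⟨c', hc₁', hc₂', hc₃'⟩ := hw'
  have hx : ∑ k, c k • inputVec g k = Pi.single 2 1 := by
    rw [← hc₃]
    simp [-Set.union_singleton, supportSum, hZw, hPw]
  have hx' : ∑ k, c' k • inputVec g k = Pi.single 0 1 := by
    rw [← hc₃']
    simp [-Set.union_singleton, supportSum, hZw', hPw']
  have hne : w ≠ w' := by
    rintro rfl
    exact hZw hZw'
  have hcc : ∀ k, c k = 0 ∨ c' k = 0 := by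
    intro k
    by_contra h
    push Not at h
    exact hne ((hc₂ k h.1).symm.trans (hc₂' k h.2))
  refine ⟨c + c', fun k => ?_, fun k hk => ?_, ?_, fun A => ?_⟩
  · rcases hcc k with h | h
    · simpa [h] using hc₁' k
    · simpa [h] using hc₁ k
  · rcases hcc k with h | h
    · rw [hc₂' k (by simpa [h] using hk)]
      exact ⟨hCw', hwt'.mono Set.subset_union_right⟩
    · rw [hc₂ k (by simpa [h] using hk)]
      exact ⟨hCw, hwt.mono Set.subset_union_right⟩
  · simp only [Pi.add_apply, add_smul, Finset.sum_add_distrib, hx, hx']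
    exact add_comm _ _
  · have : (∑ k, if N.inputNode k ∈ A then (c + c') k • inputVec g k else 0) =
        (if w ∈ A then Pi.single 2 1 else 0) + if w' ∈ A then Pi.single 0 1 else 0 := by
      rw [← hx, ← hx', ← part c w A hc₂, ← part c' w' A hc₂', ← Finset.sum_add_distrib]
      refine Finset.sum_congr rfl fun k _ => ?_
      split_ifs
      · rw [Pi.add_apply, add_smul]
      · rw [add_zero]
    rw [this]
    by_cases hA : w ∈ A <;> by_cases hA' : w' ∈ A <;> simp only [hA, hA', if_true, if_false]
    · exact Or.inr (Or.inr (Or.inr ⟨⟨w', hA', hS₀ hZw'⟩, w, hA, hS₂ hPw⟩))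
    · exact Or.inr (Or.inl ⟨add_zero _, w, hA, hS₂ hPw⟩)
    · exact Or.inr (Or.inr (Or.inl ⟨zero_add _, w', hA', hS₀ hZw'⟩))
    · exact Or.inl (add_zero _)

end Splitting

end Split

/-! ### From a splitting to an XOR code. -/

section Assembly

variable {V E : Type*} {N : SumNetwork V E (Fin 3) (Fin 3)} {e : E} {m : V} {X Q : Set E}

/-- Before `e`, three prescriptions apply: `splitVec` on edges leading to terminal 2 off `e`, the
sum of the arrived x₁, x₂ on edges leading to `e`, and x₀ on edges fed by source 0 alone. They agree
where they overlap. A forest on edges not leading to terminal 2 off `e` brings x₁ and the roots of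
`exists_roots` to terminal 0; `hW` makes it compatible with the prescriptions. The rest is
`xorSolvable_of_code_before`. -/
theorem Splitting.xorSolvable [DecidableEq V] [Fintype E] (K : N.Splitting e m X Q)
    (B : N.Bottleneck e)
    (hW : ∀ w, N.FromSource 1 w → N.FromSource 2 w → N.Reach ∅ w (N.tail e) →
      ¬ N.Reach ∅ w (N.terminal 0)) : N.XORSolvableOverAllFields := by
  classical
  let C : V → Prop := fun a => N.Reach {e} a (N.terminal 2)
  let U : E → Prop := fun f => N.Reach ∅ (N.head f) (N.tail e) ∨ f = e
  let P : E → Prop := fun f => N.FromSource 0 (N.tail f) ∧ ¬ N.FromSource 1 (N.tail f) ∧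
    ¬ N.FromSource 2 (N.tail f)
  let sv : V → Fin 3 → ℤ := fun a =>
    supportSum (N.FromSource 1 a) (N.FromSource 2 a) (Pi.single 1 1) (Pi.single 2 1)
  let Z : Set E := {f | ¬ N.After e (N.tail f) ∧ ¬ C (N.head f)}
  let G₀ : E → Fin 3 → ℤ := fun f => if f ≠ e ∧ C (N.head f) then N.splitVec e m X Q f else
    if U f then sv (N.tail f) else if P f then Pi.single 0 1 else 0
  have snoc : ∀ {i f}, N.FromSource i (N.tail f) → N.FromSource i (N.head f) :=
    fun h => Reach.snoc h (Set.notMem_empty _)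
  have hCe : C (N.head e) :=
    Reach.avoid_of_after B.terminal_two (Reach.refl _ _ _)
  have hCtail : ∀ {f}, f ≠ e → C (N.head f) → C (N.tail f) :=
    fun hf h => Reach.cons (by simpa using hf) h
  have hUtail : ∀ {f}, U f → N.Reach ∅ (N.tail f) (N.tail e) := by
    rintro f (h | rfl)
    exacts [h.cons (Set.notMem_empty f), Reach.refl _ _ _]
  have hC₁ : ∀ {a}, ¬ N.After e a → C a → ¬ N.FromSource 1 a := fun hD hC h =>
    B.cut_one_two ((Reach.avoid_of_not_after h hD).trans hC)
  have hG₀C : ∀ f, f ≠ e → C (N.head f) → G₀ f = N.splitVec e m X Q f :=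
    fun f h₁ h₂ => if_pos ⟨h₁, h₂⟩
  have hG₀U : ∀ f, ¬ N.After e (N.tail f) → U f → G₀ f = sv (N.tail f) := by
    intro f hD hU
    by_cases h : f ≠ e ∧ C (N.head f)
    · rw [hG₀C f h.1 h.2]
      exact K.splitVec_of_reach_tail B (hCtail h.1 h.2) hD (hUtail hU)
    · simp only [G₀, if_neg h, if_pos hU]
  have hPU : ∀ f, P f → ¬ U f := fun f hP hU =>
    B.source_zero (Reach.trans hP.1 (hUtail hU))
  have hG₀P : ∀ f, ¬ N.After e (N.tail f) → P f → G₀ f = Pi.single 0 1 := by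
    intro f hD hP
    by_cases h : f ≠ e ∧ C (N.head f)
    · rw [hG₀C f h.1 h.2]
      exact K.splitVec_of_only_zero hD hP.1 hP.2.2
    · simp only [G₀, if_neg h, if_neg (hPU f hP), if_pos hP]
  have hZt : ∀ {a}, N.Reach {f | C (N.head f)} a (N.terminal 0) →
      N.Reach Zᶜ a (N.terminal 0) := fun h => h.restrict fun f hf _ hf' => not_not.2
        ⟨fun hD => B.terminal_zero (hD.trans (hf'.empty.cons (Set.notMem_empty f))), hf⟩
  obtain ⟨c, hc₁, hc₂, hc₃, hc₄⟩ := K.exists_roots B (g := G₀) fun f h₁ h₂ _ => hG₀C f h₁ h₂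
  have hD₀ : ∀ k, c k ≠ 0 → ¬ N.After e (N.inputNode k) := fun k hk h =>
    B.terminal_zero (h.trans (hc₂ k hk).2)
  have hc0 : c (Sum.inl 1) = 0 := by
    by_contra h
    exact B.cut_one_two (hc₂ _ h).1
  -- Source 1 is not among the roots, since roots lead to terminal 2 off `e`; it is added to supply
  -- x₁.
  let c' : Fin 3 ⊕ E → ℤ := c + Pi.single (Sum.inl 1) 1
  have hc'1 : c' (Sum.inl 1) = 1 := by simp [c', hc0]
  have hc'2 : ∀ k, k ≠ Sum.inl 1 → c' k = c k := fun k hk => by simp [c', hk]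
  have hc's : ∀ k, IsSign (c' k) := by
    intro k
    by_cases hk : k = Sum.inl 1
    · rw [hk, hc'1]; exact IsSign.one
    · rw [hc'2 k hk]; exact hc₁ k
  have hc'Z : ∀ f ∈ Z, c' (Sum.inr f) = 0 := by
    intro f hf
    rw [hc'2 _ (by simp)]
    by_contra h
    exact hf.2 (hc₂ _ h).1
  have hc't : ∀ k, c' k ≠ 0 → N.Reach Zᶜ (N.inputNode k) (N.terminal 0) := by
    intro k hk
    by_cases h : k = Sum.inl 1
    · subst h
      refine (B.conn 1 0).restrict fun f _ hf hf' => not_not.2 ?_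
      have hD : ¬ N.After e (N.head f) := fun hD => B.terminal_zero (hD.trans hf')
      exact ⟨fun hD' => hD (hD'.trans (Reach.edge (Set.notMem_empty f))),
        fun hC => hC₁ hD hC (hf.snoc (Set.notMem_empty f))⟩
    · rw [hc'2 k h] at hk
      exact hZt (hc₂ k hk).2
  have hc'sum : ∀ A : Set V, (∑ k, if N.inputNode k ∈ A then c' k • inputVec G₀ k else 0) =
      (if N.source 1 ∈ A then Pi.single 1 1 else 0) +
        ∑ k, if N.inputNode k ∈ A then c k • inputVec G₀ k else 0 := by
    intro A
    have : ∀ k, (if N.inputNode k ∈ A then c' k • inputVec G₀ k else 0) =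
        (if k = Sum.inl 1 then if N.source 1 ∈ A then Pi.single 1 1 else 0 else 0) +
          if N.inputNode k ∈ A then c k • inputVec G₀ k else 0 := by
      intro k
      by_cases hk : k = Sum.inl 1
      · subst hk
        simp [hc'1, hc0, inputNode, inputVec]
      · rw [hc'2 k hk, if_neg hk, zero_add]
    simp only [this, Finset.sum_add_distrib, Finset.sum_ite_eq', Finset.mem_univ, if_true]
  obtain ⟨tv, htv₁, htv₂, htv₃⟩ := N.exists_forest_code Z (N.terminal 0) (N.terminal 0) c' c' hc's
    hc's hc'Z hc'Z hc't hc't (fun _ _ _ => rfl) G₀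
  have htv₄ : ∀ f, ∃ A : Set V, (∀ b ∈ A, N.Reach ∅ b (N.tail f)) ∧
      tv f = (if N.source 1 ∈ A then Pi.single 1 1 else 0) +
        ∑ k, if N.inputNode k ∈ A then c k • inputVec G₀ k else 0 := by
    intro f
    obtain ⟨A, hA, h⟩ := htv₂ f
    exact ⟨A, fun b hb => (hA b hb).empty, (or_self_iff.1 h).trans (hc'sum A)⟩
  -- An edge used by the forest leads to terminal 0. If it also leads to `e`, `hW` forbids that
  -- sources 1 and 2 both feed it, so a nonzero partial sum is the one symbol prescribed. If source
  -- 0 alone feeds it, only x₀ can have been collected.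
  have compat : ∀ f ∈ Z, tv f ≠ 0 → U f ∨ P f → G₀ f = tv f := by
    intro f hf hne hUP
    obtain ⟨A, hA, htv⟩ := htv₄ f
    have hs : ∀ {i}, (∃ a ∈ A, N.FromSource i a) → N.FromSource i (N.tail f) := by
      rintro i ⟨a, ha, h⟩
      exact Reach.trans h (hA a ha)
    rcases hUP with hU | hP
    · rw [hG₀U f hf.1 hU]
      have h₀ : ¬ N.FromSource 0 (N.tail f) := fun h => B.source_zero (Reach.trans h (hUtail hU))
      have h₁₂ : N.FromSource 1 (N.tail f) → ¬ N.FromSource 2 (N.tail f) := fun h₁ h₂ =>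
        hW _ h₁ h₂ (hUtail hU) (((or_self_iff.1 (htv₁ f hne)).empty).cons (Set.notMem_empty f))
      rcases hc₄ A with h | ⟨h, h'⟩ | ⟨-, h'⟩ | ⟨h', -⟩
      · rw [h, add_zero] at htv
        by_cases h₁ : N.source 1 ∈ A
        · have k := hs ⟨_, h₁, Reach.refl _ _ _⟩
          rw [htv, if_pos h₁]
          simp [sv, supportSum, k, h₁₂ k]
        · rw [if_neg h₁] at htv
          exact (hne htv).elim
      · have k := hs h'
        have k' : ¬ N.FromSource 1 (N.tail f) := fun h => h₁₂ h k
        rw [htv, h, if_neg fun h₁ => k' (hs ⟨_, h₁, Reach.refl _ _ _⟩)]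
        simp [sv, supportSum, k, k']
      · exact (h₀ (hs h')).elim
      · exact (h₀ (hs h')).elim
    · rw [hG₀P f hf.1 hP]
      rw [if_neg fun h₁ => hP.2.1 (hs ⟨_, h₁, Reach.refl _ _ _⟩), zero_add] at htv
      rcases hc₄ A with h | ⟨-, h'⟩ | ⟨h, -⟩ | ⟨-, h'⟩
      · exact (hne (htv.trans h)).elim
      · exact (hP.2.2 (hs h')).elim
      · rw [htv, h]
      · exact (hP.2.2 (hs h')).elim
  let G : E → Fin 3 → ℤ := fun f => if f ∈ Z ∧ ¬ U f ∧ ¬ P f then tv f else G₀ f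
  have hGZ : ∀ f ∉ Z, G f = G₀ f := fun f hf => if_neg fun h => hf h.1
  have hGU : ∀ f, ¬ N.After e (N.tail f) → U f → G f = sv (N.tail f) := fun f hD hU =>
    (if_neg fun h => h.2.1 hU).trans (hG₀U f hD hU)
  have hGP : ∀ f, ¬ N.After e (N.tail f) → P f → G f = Pi.single 0 1 := fun f hD hP =>
    (if_neg fun h => h.2.2 hP).trans (hG₀P f hD hP)
  have hGC : ∀ f, f ≠ e → C (N.head f) → G f = N.splitVec e m X Q f := fun f h₁ h₂ =>
    (hGZ f fun h => h.2 h₂).trans (hG₀C f h₁ h₂)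
  obtain ⟨hd₁, hd₂, -⟩ := htv₃ G hGZ fun f hf hne => by
    by_cases h : U f ∨ P f
    · exact (if_neg fun h' => h.elim h'.2.1 h'.2.2).trans (compat f hf hne h)
    · push Not at h
      exact if_pos ⟨hf, h⟩
  have hc'total : ∑ k, c' k • inputVec G₀ k = 1 := by
    have := hc'sum Set.univ
    simp only [Set.mem_univ, if_true, hc₃] at this
    rw [this, ← sum_single_one, Fin.sum_univ_three]
    abel
  have hdU : ∀ f, ¬ N.After e (N.tail f) → U f → N.Derivable G (N.tail f) (sv (N.tail f)) := by
    intro f hD hU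
    have hin : ∀ f', N.head f' = N.tail f → G f' = sv (N.tail f') := fun f' h =>
      hGU f' (fun h' => hD (h ▸ h'.trans (Reach.edge (Set.notMem_empty f'))))
        (Or.inl (h ▸ hUtail hU))
    refine derivable_supportSum (single_one_ne (by decide)) (fun h => ?_) fun h => ?_
    · rcases Reach.cases_snoc h with h | ⟨f', -, hf', hh⟩
      · exact ⟨Sum.inl 1, h.symm, Or.inl rfl⟩
      · refine ⟨Sum.inr f', hh, ?_⟩
        have k : N.FromSource 1 (N.tail f') := hf'
        by_cases h₂ : N.FromSource 2 (N.tail f')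
        · exact Or.inr ⟨hh ▸ snoc h₂, by simp [inputVec, hin f' hh, sv, supportSum, k, h₂]⟩
        · exact Or.inl (by simp [inputVec, hin f' hh, sv, supportSum, k, h₂])
    · rcases Reach.cases_snoc h with h | ⟨f', -, hf', hh⟩
      · exact ⟨Sum.inl 2, h.symm, Or.inl rfl⟩
      · refine ⟨Sum.inr f', hh, ?_⟩
        have k : N.FromSource 2 (N.tail f') := hf'
        by_cases h₁ : N.FromSource 1 (N.tail f')
        · exact Or.inr ⟨hh ▸ snoc h₁, by simp [inputVec, hin f' hh, sv, supportSum, k, h₁]⟩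
        · exact Or.inl (by simp [inputVec, hin f' hh, sv, supportSum, k, h₁])
  have hdP : ∀ f, ¬ N.After e (N.tail f) → P f → N.Derivable G (N.tail f) (Pi.single 0 1) := by
    intro f hD hP
    rcases Reach.cases_snoc hP.1 with h | ⟨f', -, hf', hh⟩
    · exact derivable_source 0 h.symm
    · refine SumNetwork.derivable_edge f' hh (hGP f' ?_ ⟨hf', ?_, ?_⟩)
      · exact fun h => hD (hh ▸ h.trans (Reach.edge (Set.notMem_empty f')))
      · exact fun h => hP.2.1 (hh ▸ snoc h)
      · exact fun h => hP.2.2 (hh ▸ snoc h)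
  refine B.xorSolvable_of_code_before G (fun f hD => ?_) (hc'total ▸ hd₂) ?_
    (fun f hD h₀ h₁ h₂ => hGP f hD ⟨h₀, h₁, h₂⟩) ?_
  · by_cases hfe : f = e
    · rw [hGU f hD (Or.inr hfe)]
      exact hdU f hD (Or.inr hfe)
    by_cases hC : C (N.head f)
    · rw [hGC f hfe hC]
      refine K.derivable_edge (hCtail hfe hC) hD fun f' hh => hGC f' ?_ (hh ▸ hCtail hfe hC)
      exact After.ne_of_head (hh ▸ hD)
    by_cases hU : U f
    · rw [hGU f hD hU]
      exact hdU f hD hU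
    by_cases hP : P f
    · rw [hGP f hD hP]
      exact hdP f hD hP
    · rw [show G f = tv f from if_pos ⟨⟨hD, hC⟩, hU, hP⟩]
      exact hd₁ f
  · rw [hGU e not_after_tail (Or.inr rfl)]
    simp [sv, supportSum, B.source_one, B.source_two]
  · have hterm : ∀ {f}, f ≠ e → ¬ N.After e (N.tail f) → N.After e (N.head f) →
        N.Reach ∅ (N.head f) (N.terminal 2) → G f = N.splitVec e m X Q f ∧
        ¬ (N.FromSource 2 (N.tail f) ∧ ¬ N.Reach ∅ m (N.tail f)) := by
      intro f hfe hD hD' ht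
      refine ⟨hGC f hfe (ht.avoid_of_after hD'), fun h => h.2 (K.through _ hD h.1 (Or.inr ?_))⟩
      have hX : ∀ f' ∈ X, ¬ N.After e (N.head f') := fun f' hf' h =>
        B.terminal_zero (h.trans ((K.into f' hf').1 ▸ K.two_zero))
      refine Reach.cons ?_ ((ht.avoid_of_after hD').restrict (R' := X ∪ {e}) fun f' hf' hr _ => ?_)
      · rintro (h | h)
        exacts [hX f h hD', hfe h]
      · rintro (h | h)
        exacts [hX f' h ((hD'.trans hr).trans (Reach.edge (Set.notMem_empty f'))), hf' h]
    -- Either an edge of `Q` brings x₀ alone, or `f` brings x₂ alone and `f'` brings x₀ or x₀ + x₂,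
    -- from which `f` is subtracted if necessary.
    rcases K.decode with ⟨f, hQ, h₁, h₂, h₃, h₄⟩ | ⟨⟨f, hQ, h₁, h₂, h₃, h₄, h₅, h₆⟩,
      f', k₁, k₂, k₃, k₄, k₅⟩
    · obtain ⟨hf, hz⟩ := hterm h₁ h₂ h₃ h₄
      refine ⟨Pi.single f 1, fun k => ?_, fun k hk => ?_, ?_⟩
      · by_cases h : k = f
        · subst h; simpa using IsSign.one
        · simpa [h] using IsSign.zero
      · obtain rfl : k = f := by
          by_contra h
          simp [h] at hk
        exact ⟨h₁, h₂, h₃, h₄, Or.inl (K.carry k hQ).2.1.empty⟩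
      · simp [Pi.single_apply, hf, splitVec, if_neg hz, hQ]
    · obtain ⟨hf, hz⟩ := hterm h₁ h₂ h₃ h₄
      obtain ⟨hf', hz'⟩ := hterm k₁ k₂ k₃ k₄
      have hne : f' ≠ f := by
        rintro rfl
        exact h₅ k₅
      have hv : G f = Pi.single 2 1 := by
        rw [hf, splitVec, if_neg hz, if_neg hQ]
        simp [-Set.union_singleton, supportSum, h₅, h₆]
      have hv' : G f' = Pi.single 0 1 ∨ G f' = Pi.single 0 1 + Pi.single 2 1 := by
        rw [hf', splitVec, if_neg hz']
        by_cases hQ' : f' ∈ Q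
        · exact Or.inl (if_pos hQ')
        · rw [if_neg hQ']
          by_cases hP : N.Reach Q m (N.tail f')
          · exact Or.inr (by simp [-Set.union_singleton, supportSum, hP, k₅])
          · exact Or.inl (by simp [-Set.union_singleton, supportSum, hP, k₅])
      have hr' : N.FromSource 0 (N.tail f') ∨ N.FromSource 2 (N.tail f') := Or.inl k₅.empty
      have hr : N.FromSource 0 (N.tail f) ∨ N.FromSource 2 (N.tail f) :=
        Or.inr (Reach.trans K.from_two h₆.empty)
      rcases hv' with hv' | hv'
      · refine ⟨Pi.single f' 1, fun k => ?_, fun k hk => ?_, ?_⟩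
        · by_cases h : k = f'
          · subst h; simpa using IsSign.one
          · simpa [h] using IsSign.zero
        · obtain rfl : k = f' := by
            by_contra h
            simp [h] at hk
          exact ⟨k₁, k₂, k₃, k₄, hr'⟩
        · simp [Pi.single_apply, hv']
      · refine ⟨Pi.single f' 1 - Pi.single f 1, fun k => ?_, fun k hk => ?_, ?_⟩
        · by_cases h : k = f'
          · subst h; simpa [hne] using IsSign.one
          · by_cases h' : k = f
            · subst h'; simpa [h] using IsSign.neg_one
            · simpa [h, h'] using IsSign.zero
        · by_cases h : k = f'
          · subst h; exact ⟨k₁, k₂, k₃, k₄, hr'⟩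
          · by_cases h' : k = f
            · subst h'; exact ⟨h₁, h₂, h₃, h₄, hr⟩
            · simp [h, h'] at hk
        · simp [Pi.single_apply, sub_smul, Finset.sum_sub_distrib, hv, hv']

end Assembly

/-! ### Existence of a splitting. -/

section Existence

variable {V E : Type*} {N : SumNetwork V E (Fin 3) (Fin 3)} {e : E} {m : V} {X Q : Set E}

/-- Edge-disjoint paths from `m` to the terminals `0` and `2` give a splitting. -/
theorem exists_splitting_of_disjoint (B : N.Bottleneck e) (from_two : N.FromSource 2 m)
    (through : ∀ a, ¬ N.After e a → N.FromSource 2 a →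
      (N.Reach (X ∪ {e}) a (N.terminal 0) ∨ N.Reach (X ∪ {e}) a (N.terminal 2)) → N.Reach ∅ m a)
    (into : ∀ f ∈ X, N.head f = m ∧ N.FromSource 2 (N.tail f))
    (start : m = N.source 2 ∨ X.Nonempty)
    (zero_two : N.Reach (X ∪ {e}) (N.source 0) (N.terminal 2))
    (zero_zero : N.Reach (X ∪ {e}) (N.source 0) (N.terminal 0))
    (hQ₀ : N.Reach (Q ∪ {e}) m (N.terminal 0)) (hQ₂ : N.Reach (Qᶜ ∪ {e}) m (N.terminal 2)) :
    ∃ Q, N.Splitting e m X Q := by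
  have hX : ∀ f ∈ X, ¬ N.Reach ∅ m (N.tail f) := fun f hf h => by
    rw [← (into f hf).1] at h
    exact h.not_back
  have hZ : ∀ {a b}, N.Reach ∅ m a → N.Reach (X ∪ {e}) (N.source 0) a → N.Reach (Qᶜ ∪ {e}) a b →
      N.Reach (X ∪ {e}) (N.source 0) b := by
    intro a b ha h hab
    refine h.trans (hab.restrict fun f hf hf' _ => ?_)
    rintro (h | h)
    exacts [hX f h (ha.trans hf'.empty), hf (Or.inr h)]
  -- The path to terminal 2 runs inside `Q`. It carries x₂ alone until x₀ can join; from there on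
  -- its edges are in `Q'` and carry x₀, with x₂ subtracted at the junction.
  let Q' : Set E := {f | f ∈ Q ∧ f ≠ e ∧ N.Reach (Qᶜ ∪ {e}) m (N.tail f) ∧
    N.Reach (X ∪ {e}) (N.source 0) (N.tail f)}
  have hP : ∀ {a}, N.Reach (Qᶜ ∪ {e}) m a → ¬ N.Reach (X ∪ {e}) (N.source 0) a →
      N.Reach Q' m a := by
    intro a ha hza
    refine ha.restrict fun f hf hf' hfa hQ' => hza ?_
    exact hZ hf'.empty hQ'.2.2.2 (hfa.cons hf)
  refine ⟨Q', from_two, hQ₂.mono Set.subset_union_right, through, into, start, zero_two, zero_zero,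
    fun f hf => ?_, hQ₀.mono fun f hf => Or.inl hf.1, ?_⟩
  · obtain ⟨-, -, hr, hz⟩ := hf
    refine ⟨fun h => hX f h hr.empty, hz, ?_⟩
    rcases hr.cases_snoc with h | ⟨f', hf', hr', hh⟩
    · exact Or.inr (Or.inr (Or.inl h))
    · have hf'Q : f' ∈ Q := not_not.1 fun h => hf' (Or.inl h)
      by_cases hz' : N.Reach (X ∪ {e}) (N.source 0) (N.tail f')
      · exact Or.inr (Or.inl ⟨f', ⟨hf'Q, fun h => hf' (Or.inr h), hr', hz'⟩, hh⟩)
      · exact Or.inr (Or.inr (Or.inr ⟨f', fun h => hz' h.2.2.2, hh, hz', hP hr' hz'⟩))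
  · have hm : ¬ N.After e m := fun h => B.terminal_zero (h.trans hQ₀)
    obtain ⟨f, hf, hD, hD', hr, hr'⟩ := hQ₂.entry (D := N.After e) hm B.terminal_two
    have hfQ : f ∈ Q := not_not.1 fun h => hf (Or.inl h)
    have hfe : f ≠ e := fun h => hf (Or.inr h)
    -- If x₀ never joined before the region behind `e`, the path delivers x₂ alone and a path from
    -- source 0 delivers x₀, possibly mixed with x₂.
    by_cases hz : N.Reach (X ∪ {e}) (N.source 0) (N.tail f)
    · exact Or.inl ⟨f, ⟨hfQ, hfe, hr, hz⟩, hfe, hD, hD', hr'.empty⟩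
    · obtain ⟨f', hf', k₁, k₂, k₃, k₄⟩ :=
        zero_two.entry (D := N.After e) (B.not_after_source 0) B.terminal_two
      exact Or.inr ⟨⟨f, fun h => hz h.2.2.2, hfe, hD, hD', hr'.empty, hz, hP hr hz⟩,
        f', fun h => hf' (Or.inr h), k₁, k₂, k₄.empty, k₃⟩

/-- In the network without `e`, if no edge cuts source 2 off from both terminals 0 and 2, Menger
applies at source 2. Otherwise let `g` be a last such edge; by `hno`, source 0 reaches terminal 2
off `g`. If it also reaches terminal 0 off `g`, Menger applies at the head of `g`, with `X = {g}`
delivering x₂. If not, paths of source 0 to terminal 2 off `g` can be reserved for x₀ without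
obstructing x₂. -/
theorem exists_splitting [Finite E] (B : N.Bottleneck e)
    (hno : ∀ h, N.Reach (insert h {e}) (N.source 0) (N.terminal 2) ∨
      N.Reach (insert h {e}) (N.source 2) (N.terminal 0) ∨
      N.Reach (insert h {e}) (N.source 2) (N.terminal 2)) :
    ∃ m X Q, N.Splitting e m X Q := by
  have h₂₀ : N.Reach {e} (N.source 2) (N.terminal 0) :=
    (B.conn 2 0).avoid_of_not_after B.terminal_zero
  by_cases hcut : ∃ g, ¬ N.Reach (insert g {e}) (N.source 2) (N.terminal 0) ∧
      ¬ N.Reach (insert g {e}) (N.source 2) (N.terminal 2)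
  swap
  · push Not at hcut
    obtain ⟨Q, hQ₀, hQ₂⟩ := h₂₀.exists_disjoint B.reach_two_two
      (N.source_ne_terminal 2 0).symm (N.source_ne_terminal 2 2).symm hcut
    exact ⟨_, ∅, exists_splitting_of_disjoint B (Reach.refl _ _ _) (fun a _ h _ => h) (by simp)
      (Or.inl rfl) (by simpa using B.reach_zero 2) (by simpa using B.reach_zero 0) hQ₀ hQ₂⟩
  -- Minimal for the reversed order means last: a common cut of both terminals from the head of `g`
  -- would be a later edge of the same kind.
  obtain ⟨g, ⟨hg₀, hg₂⟩, hmax⟩ := N.wellFounded_edgeReach_swap.has_min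
    {g | ¬ N.Reach (insert g {e}) (N.source 2) (N.terminal 0) ∧
      ¬ N.Reach (insert g {e}) (N.source 2) (N.terminal 2)} hcut
  have h02 : N.Reach (insert g {e}) (N.source 0) (N.terminal 2) :=
    ((hno g).resolve_right fun h => h.elim hg₀ hg₂)
  obtain ⟨hge, hsg, hgt₀⟩ := (h₂₀.split g).resolve_left hg₀
  obtain ⟨-, -, hgt₂⟩ := (B.reach_two_two.split g).resolve_left hg₂
  by_cases h00 : N.Reach (insert g {e}) (N.source 0) (N.terminal 0)
  · have hgt₀' : N.Reach {e} (N.head g) (N.terminal 0) := hgt₀.mono (Set.subset_insert _ _)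
    have hgt₂' : N.Reach {e} (N.head g) (N.terminal 2) := hgt₂.mono (Set.subset_insert _ _)
    have hne₀ : N.terminal 0 ≠ N.head g := fun h =>
      B.cut_one_two (((B.conn 1 0).avoid_of_not_after B.terminal_zero).trans (h ▸ hgt₂'))
    have hne₂ : N.terminal 2 ≠ N.head g := fun h =>
      B.terminal_zero (B.terminal_two.trans (h ▸ hgt₀'))
    obtain ⟨Q, hQ₀, hQ₂⟩ := hgt₀'.exists_disjoint hgt₂' hne₀ hne₂ fun h hh => by
      by_contra hh'
      have hcut' : ∀ j, ¬ N.Reach (insert g {e}) (N.source 2) (N.terminal j) →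
          ¬ N.Reach (insert h {e}) (N.head g) (N.terminal j) →
          ¬ N.Reach (insert h {e}) (N.source 2) (N.terminal j) := by
        intro j hj hj' hr
        rcases hr.split g with k | ⟨-, -, k⟩
        · exact hj (k.mono (Set.insert_subset_insert (Set.subset_insert _ _)))
        · exact hj' (k.mono (Set.subset_insert _ _))
      refine hmax h ⟨hcut' 0 hg₀ hh, hcut' 2 hg₂ hh'⟩ ?_
      exact ((hgt₀'.split h).resolve_left hh).2.1.empty
    refine ⟨N.head g, {g}, exists_splitting_of_disjoint B
      (hsg.empty.snoc (Set.notMem_empty g)) (fun a hD ha hr => ?_) ?_ (Or.inr ⟨g, rfl⟩)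
      (by rwa [Set.singleton_union]) (by rwa [Set.singleton_union]) hQ₀ hQ₂⟩
    · rw [Set.singleton_union] at hr
      rcases (Reach.avoid_of_not_after ha hD).split g with k | ⟨-, -, k⟩
      · exact hr.elim (fun hr => (hg₀ (k.trans hr)).elim) fun hr => (hg₂ (k.trans hr)).elim
      · exact k.empty
    · rintro f rfl
      exact ⟨rfl, hsg.empty⟩
  · let Q : Set E := {f | f ∉ (insert g {e} : Set E) ∧
      N.Reach (insert g {e}) (N.source 0) (N.tail f) ∧
      N.Reach (insert g {e}) (N.head f) (N.terminal 2)}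
    have hz : ∀ {a}, N.Reach (insert g {e}) (N.source 0) a →
        N.Reach (∅ ∪ {e}) (N.source 0) a := fun h => h.mono (by simp)
    refine ⟨N.source 2, ∅, Q, Reach.refl _ _ _, B.reach_two_two, fun a _ h _ => h, by simp,
      Or.inl rfl, hz h02, by simpa using B.reach_zero 0, fun f hf => ?_, ?_, Or.inl ?_⟩
    · refine ⟨Set.notMem_empty _, hz hf.2.1, ?_⟩
      rcases hf.2.1.cases_snoc with h | ⟨f', hf', hr, hh⟩
      · exact Or.inl h
      · exact Or.inr (Or.inl ⟨f', ⟨hf', hr, hh ▸ hf.2.2.cons hf.1⟩, hh⟩)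
    · refine h₂₀.restrict fun f hf hsf hft hQ => ?_
      obtain ⟨hfg, hzf, hf2⟩ := hQ
      rcases hsf.split g with k | ⟨-, -, k⟩
      · exact hg₂ (k.trans (hf2.cons hfg))
      · refine h00 ((hzf.snoc hfg).trans (hft.avoid_left fun hback => ?_))
        exact (k.empty.trans (hback.cons (Set.notMem_empty f))).not_back
    · obtain ⟨f, hf, k₁, k₂, k₃, k₄⟩ :=
        h02.entry (D := N.After e) (B.not_after_source 0) B.terminal_two
      exact ⟨f, ⟨hf, k₃, k₄⟩, fun h => hf (Or.inr h), k₁, k₂, k₄.empty⟩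

end Existence

/-! ### The case distinction and the theorem. -/

section Main

variable {V E : Type*} {N : SumNetwork V E (Fin 3) (Fin 3)} {e₂ : E}

/-- Outside the two easy cases `e₂` is a bottleneck, and an edge blocking every splitting would
satisfy the six conditions with it. -/
theorem xorSolvable_of_no_sixConditions [DecidableEq V] [Fintype E] (hconn : N.Connected)
    (he₂ : N.Conditions34 N.source N.terminal e₂)
    (h₂₂ : N.Reach {e₂} (N.source 2) (N.terminal 2))
    (hno : ¬ ∃ e₁, e₁ ≠ e₂ ∧ N.SixConditions N.source N.terminal e₁ e₂) :
    N.XORSolvableOverAllFields := by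
  have c3 := mincut_singleton_eq_zero_iff.1 he₂.cond3
  have c4 := mincut_pair_eq_zero_iff.1 he₂.cond4
  have through : ∀ {a b}, N.Reach ∅ a b → ¬ N.Reach {e₂} a b →
      N.Reach ∅ a (N.tail e₂) ∧ N.After e₂ b := fun {a b} h h' => by
    rcases h.split e₂ with k | ⟨-, k, k'⟩
    · exact (h' (by simpa using k)).elim
    · exact ⟨k.empty, k'.empty⟩
  have s₁ := (through (hconn 1 2) c3).1
  have t₂ := (through (hconn 1 2) c3).2
  have s₂ := (through (hconn 2 1) c4.2).1
  have t₁ := (through (hconn 2 1) c4.2).2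
  by_cases s₀ : N.FromSource 0 (N.tail e₂)
  · refine xorSolvable_of_sum_edge hconn (e := e₂) (fun i => ?_) t₁ t₂
    fin_cases i
    exacts [s₀, s₁, s₂]
  by_cases hW : ∃ w, N.FromSource 1 w ∧ N.FromSource 2 w ∧ N.Reach ∅ w (N.tail e₂) ∧
      N.Reach ∅ w (N.terminal 0)
  · obtain ⟨w, h₁, h₂, hu, h₀⟩ := hW
    have hv := hu.snoc (Set.notMem_empty e₂)
    refine xorSolvable_of_pair_node hconn (fun h => s₀ (h.trans hu)) h₁ h₂ fun j => ?_
    fin_cases j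
    exacts [h₀, hv.trans t₁, hv.trans t₂]
  push Not at hW
  -- Otherwise the tail of `e₂` would itself be a node excluded by `hW`.
  have t₀ : ¬ N.After e₂ (N.terminal 0) := fun h =>
    hW _ s₁ s₂ (Reach.refl _ _ _) (Reach.cons (Set.notMem_empty e₂) h)
  have B : N.Bottleneck e₂ := ⟨hconn, s₀, s₁, s₂, t₀, t₁, t₂, c4.1, c3, c4.2, h₂₂⟩
  obtain ⟨m, X, Q, K⟩ := exists_splitting B fun e₁ => by
    by_contra h
    push Not at h
    obtain ⟨h₁, h₂, h₃⟩ := h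
    have k₁ : ¬ N.Reach {e₁} (N.source 0) (N.terminal 2) := fun h => by
      have := h.avoid_left (f := e₂) s₀
      rw [Set.pair_comm] at this
      exact h₁ this
    have k₂ : ¬ N.Reach {e₁} (N.source 2) (N.terminal 0) := fun h => by
      have := h.avoid (f := e₂) t₀
      rw [Set.pair_comm] at this
      exact h₂ this
    have hne : e₁ ≠ e₂ := by
      rintro rfl
      exact k₁ (B.reach_zero 2)
    -- Condition 6 is automatic: a path from `e₁` to `e₂` would bring source 0 to `e₂`, and one from
    -- `e₂` to `e₁` would bring `e₂` to terminal 0.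
    refine hno ⟨e₁, hne, he₂, mincut_singleton_eq_zero_iff.2 k₁, mincut_singleton_eq_zero_iff.2 k₂,
      mincut_singleton_eq_zero_iff.2 h₃, fun h => ?_, fun h => ?_⟩
    · rcases (hconn 0 2).split e₁ with k | ⟨-, k, -⟩
      · exact k₁ (by simpa using k)
      · exact s₀ ((k.empty.snoc (Set.notMem_empty e₁)).trans h)
    · rcases (hconn 2 0).split e₁ with k | ⟨-, -, k⟩
      · exact k₂ (by simpa using k)
      · exact t₀ (Reach.trans h (k.empty.cons (Set.notMem_empty e₁)))
  exact K.xorSolvable B hW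

end Main

end SumNetwork

theorem mainTheorem8 {V E : Type*} [DecidableEq V] [Fintype E]
    (N : SumNetwork V E (Fin 3) (Fin 3)) (hconn : N.Connected) (hκ : N.kappa = 3)
    (σ τ : Equiv.Perm (Fin 3)) (e₂ : E)
    (he₂ : N.Conditions34 (N.source ∘ σ) (N.terminal ∘ τ) e₂) :
    (¬ N.Solvable →
      ∃ e₁, e₁ ≠ e₂ ∧ N.SixConditions (N.source ∘ σ) (N.terminal ∘ τ) e₁ e₂) ∧
    ((¬ ∃ e₁, e₁ ≠ e₂ ∧ N.SixConditions (N.source ∘ σ) (N.terminal ∘ τ) e₁ e₂) →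
      N.XORSolvableOverAllFields) ∧
    (N.Solvable → N.XORSolvableOverAllFields) := by
  have hconn' : (N.relabel σ τ).Connected := fun i j => hconn _ _
  have six : ∀ e₁, N.SixConditions (N.source ∘ σ) (N.terminal ∘ τ) e₁ e₂ ↔
      (N.relabel σ τ).SixConditions (N.relabel σ τ).source (N.relabel σ τ).terminal e₁ e₂ :=
    fun e₁ => ⟨fun ⟨⟨h₃, h₄⟩, h₁, h₂, h₅, h₆⟩ => ⟨⟨h₃, h₄⟩, h₁, h₂, h₅, h₆⟩,
      fun ⟨⟨h₃, h₄⟩, h₁, h₂, h₅, h₆⟩ => ⟨⟨h₃, h₄⟩, h₁, h₂, h₅, h₆⟩⟩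
  have c4 := SumNetwork.mincut_pair_eq_zero_iff.1 he₂.cond4
  -- The only use of κ: conditions 3 and 4 already make `e₂` disconnect three pairs, so it cannot
  -- disconnect this fourth one.
  have h₂₂ : (N.relabel σ τ).Reach {e₂} (N.source (σ 2)) (N.terminal (τ 2)) :=
    SumNetwork.reach_of_kappa_le (p₁ := (σ 1, τ 2)) (p₂ := (σ 1, τ 1)) (p₃ := (σ 2, τ 1))
      (p := (σ 2, τ 2)) hκ.le hconn (by simp) (by simp) (by simp)
      (SumNetwork.mincut_singleton_eq_zero_iff.1 he₂.cond3) c4.1 c4.2 (by simp) (by simp) (by simp)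
  have main : (¬ ∃ e₁, e₁ ≠ e₂ ∧ N.SixConditions (N.source ∘ σ) (N.terminal ∘ τ) e₁ e₂) →
      N.XORSolvableOverAllFields := by
    intro hno
    refine SumNetwork.XORSolvableOverAllFields.of_relabel (σ := σ) (τ := τ) ?_
    refine SumNetwork.xorSolvable_of_no_sixConditions hconn' ⟨he₂.cond3, he₂.cond4⟩ h₂₂ ?_
    rintro ⟨e₁, hne, h⟩
    exact hno ⟨e₁, hne, (six e₁).2 h⟩
  refine ⟨fun h => ?_, main, fun h => main ?_⟩
  · by_contra hno
    exact h (main hno).solvable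
  · rintro ⟨e₁, hne, h₆⟩
    exact ((six e₁).1 h₆).not_solvable hconn' hne h.relabel
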